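/- Let $\mathbb K=\mathbb R$ or $\mathbb C$, let $\mathfrak s$ be a finite-dimensional semisimple Lie algebra over $\mathbb K$, let $\mathfrak g=\mathfrak s\oplus\mathbb K$ be its one-dimensional trivial central extension, and let $\pi_1$ be the canonical Lie--Poisson bivector on $\mathfrak g^*=\mathfrak s^*\oplus\mathbb K^*$. Fix $0\ne a\in\mathbb K^*\subset\mathfrak g^*$, linear coordinates $x_1,\dots,x_n$ on $\mathfrak s^*$, and the linear coordinate $x_0$ on $\mathfrak g^*$ with $x_0(a)=1$, $x_0|_{\mathfrak s^*}=0$; then $x_0,x_1,\dots,x_n$ are linear coordinates on $\mathfrak g^*$. Let $E=\sum_{i=1}^n x_i\frac{\partial}{\partial x_i}$. All polyvector fields have polynomial coefficients; "quadratic" means with homogeneous quadratic coefficients; $[\cdot,\cdot]$ is the Schouten bracket, normalized by $[X,f]=Xf$, $[X,P]=\mathcal L_XP$ for a vector field $X$ and $[P,Q\wedge R]=[P,Q]\wedge R+(-1)^{(p-1)q}Q\wedge[P,R]$ for $P,Q$ of degrees $p,q$; for a function $q$, $\pi_1(q)=[\pi_1,q]$ is the vector field $f\mapsto\{f,q\}_{\pi_1}$.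 A bivector $P$ is Poisson if $[P,P]=0$. A quadratic Poisson bivector $\pi_2$ on $\mathfrak g^*$ is called centrally linearizable (CL), with respect to $a$, if $\pi_2(a)=0$ and its linearization at $a$, $[\frac{\partial}{\partial x_0},\pi_2]$, equals $\pi_1$. (1) For every CL quadratic Poisson bivector $\pi_2$ on $\mathfrak g^*$ there exist a quadratic vector field $X$ and a homogeneous quadratic polynomial $q$ on $\mathfrak s^*$ (regarded as objects on $\mathfrak g^*$ depending only on $x_1,\dots,x_n$) such that, with $\widetilde X=X+q\frac{\partial}{\partial x_0}-x_0E$ and $\pi=[X,\pi_1]$, $$\pi_2=[\widetilde X,\pi_1]=\pi-\pi_1(q)\wedge\frac{\partial}{\partial x_0}+x_0\pi_1,$$ and the two basic identities hold: $$[\pi,\pi]=2\,\pi_1(q)\wedge\pi_1,\qquad[\pi,\pi_1(q)]=0 .$$ (2) For every quadratic vector field $X$ and every homogeneous quadratic polynomial $q$ on $\mathfrak s^*$, one has $[\widetilde X,\pi_1]=\pi-\pi_1(q)\wedge\frac{\partial}{\partial x_0}+x_0\pi_1$, and this bivector is Poisson if and only if the two basic identities hold. In both parts the basic identities may equivalently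 be read on $\mathfrak g^*$ or on $\mathfrak s^*$ (with $\pi_1$ replaced by the Lie--Poisson bivector of $\mathfrak s^*$): the pair of identities holds on $\mathfrak g^*$ if and only if it holds on $\mathfrak s^*$. -/

import Mathlib

open MvPolynomial

/-! The field `K` as a Lie algebra over itself, with the commutator bracket, which vanishes. -/

attribute [local instance] LieRing.ofAssociativeRing

noncomputable section

namespace CLPoisson

/-! Polynomial polyvector fields, as alternating multiderivations. -/

section Multiderivations

variable (K R : Type*) [Field K] [CommRing R] [Algebra K R]

/-- A bivector (field) on the space whose algebra of functions is `R`: a map `(f, g) ↦ P f g` that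
is alternating and a `K`-derivation in each argument. The `R`-module structure is pointwise. -/
def bivectors : Submodule R (R → R → R) where
  carrier := {P | (∀ f, P f f = 0) ∧
    (∀ f, ∃ D : Derivation K R R, ∀ g, D g = P f g) ∧
    (∀ g, ∃ D : Derivation K R R, ∀ f, D f = P f g)}
  zero_mem' := ⟨fun _ => rfl, fun _ => ⟨0, fun _ => rfl⟩, fun _ => ⟨0, fun _ => rfl⟩⟩
  add_mem' := by
    rintro P Q ⟨hP, hP1, hP2⟩ ⟨hQ, hQ1, hQ2⟩
    refine ⟨fun f => by simp [hP, hQ], fun f => ?_, fun g => ?_⟩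
    · obtain ⟨D, hD⟩ := hP1 f
      obtain ⟨D', hD'⟩ := hQ1 f
      exact ⟨D + D', fun g => by simp [hD, hD']⟩
    · obtain ⟨D, hD⟩ := hP2 g
      obtain ⟨D', hD'⟩ := hQ2 g
      exact ⟨D + D', fun g => by simp [hD, hD']⟩
  smul_mem' := by
    rintro r P ⟨hP, hP1, hP2⟩
    refine ⟨fun f => by simp [hP], fun f => ?_, fun g => ?_⟩
    · obtain ⟨D, hD⟩ := hP1 f
      exact ⟨r • D, fun g => by simp [hD]⟩
    · obtain ⟨D, hD⟩ := hP2 g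
      exact ⟨r • D, fun g => by simp [hD]⟩

/-- A trivector (field): an alternating map `(f, g, h) ↦ T f g h` that is a `K`-derivation in each
argument. -/
def trivectors : Submodule R (R → R → R → R) where
  carrier := {T | (∀ f g, T f f g = 0) ∧ (∀ f g, T f g g = 0) ∧
    (∀ f g, ∃ D : Derivation K R R, ∀ h, D h = T f g h) ∧
    (∀ f h, ∃ D : Derivation K R R, ∀ g, D g = T f g h) ∧
    (∀ g h, ∃ D : Derivation K R R, ∀ f, D f = T f g h)}
  zero_mem' := ⟨fun _ _ => rfl, fun _ _ => rfl, fun _ _ => ⟨0, fun _ => rfl⟩,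
    fun _ _ => ⟨0, fun _ => rfl⟩, fun _ _ => ⟨0, fun _ => rfl⟩⟩
  add_mem' := by
    rintro P Q ⟨hP, hP', hP1, hP2, hP3⟩ ⟨hQ, hQ', hQ1, hQ2, hQ3⟩
    refine ⟨fun f g => by simp [hP, hQ], fun f g => by simp [hP', hQ'],
      fun f g => ?_, fun f g => ?_, fun f g => ?_⟩
    · obtain ⟨D, hD⟩ := hP1 f g
      obtain ⟨D', hD'⟩ := hQ1 f g
      exact ⟨D + D', fun g => by simp [hD, hD']⟩
    · obtain ⟨D, hD⟩ := hP2 f g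
      obtain ⟨D', hD'⟩ := hQ2 f g
      exact ⟨D + D', fun g => by simp [hD, hD']⟩
    · obtain ⟨D, hD⟩ := hP3 f g
      obtain ⟨D', hD'⟩ := hQ3 f g
      exact ⟨D + D', fun g => by simp [hD, hD']⟩
  smul_mem' := by
    rintro r P ⟨hP, hP', hP1, hP2, hP3⟩
    refine ⟨fun f g => by simp [hP], fun f g => by simp [hP'],
      fun f g => ?_, fun f g => ?_, fun f g => ?_⟩
    · obtain ⟨D, hD⟩ := hP1 f g
      exact ⟨r • D, fun g => by simp [hD]⟩
    · obtain ⟨D, hD⟩ := hP2 f g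
      exact ⟨r • D, fun g => by simp [hD]⟩
    · obtain ⟨D, hD⟩ := hP3 f g
      exact ⟨r • D, fun g => by simp [hD]⟩

/-- Vector fields are derivations of the algebra of functions. -/
abbrev VectorField := Derivation K R R

/-- The module of bivectors. -/
abbrev Bivector := ↥(bivectors K R)

/-- The module of trivectors. -/
abbrev Trivector := ↥(trivectors K R)

variable {K R}

theorem Bivector.skew (P : Bivector K R) (f g : R) : P.1 f g = -P.1 g f := by
  obtain ⟨h0, h1, h2⟩ := P.2
  have h := h0 (f + g)
  obtain ⟨D, hD⟩ := h1 (f + g)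
  obtain ⟨D1, hD1⟩ := h2 f
  obtain ⟨D2, hD2⟩ := h2 g
  rw [← hD, map_add, hD, hD, ← hD1, ← hD2, map_add, map_add, hD1, hD1, hD2, hD2, h0, h0] at h
  linear_combination h

theorem trivector_mem_of_cyclic (T : R → R → R → R) (hc : ∀ f g h, T f g h = T g h f)
    (h0 : ∀ f g, T f f g = 0)
    (h1 : ∀ g h, ∃ D : Derivation K R R, ∀ f, D f = T f g h) : T ∈ trivectors K R := by
  refine ⟨h0, fun f g => by rw [hc, h0], fun f g => ?_, fun f h => ?_, h1⟩
  · obtain ⟨D, hD⟩ := h1 f g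
    exact ⟨D, fun h => by rw [hD, hc]⟩
  · obtain ⟨D, hD⟩ := h1 h f
    exact ⟨D, fun g => by rw [hD, hc f]⟩

/-- `P(q) = [P, q]`: the contraction of the bivector `P` with `dq` over the second index, that is,
the vector field `f ↦ P(f, q)`. -/
def ham (P : Bivector K R) (q : R) : VectorField K R where
  toFun f := P.1 f q
  map_add' f g := by
    obtain ⟨D, hD⟩ := P.2.2.2 q
    simp only [← hD, map_add]
  map_smul' c f := by
    obtain ⟨D, hD⟩ := P.2.2.2 q
    simp only [← hD, Derivation.map_smul, RingHom.id_apply]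
  map_one_eq_zero' := by
    obtain ⟨D, hD⟩ := P.2.2.2 q
    change P.1 1 q = 0
    rw [← hD, D.map_one_eq_zero]
  leibniz' f g := by
    obtain ⟨D, hD⟩ := P.2.2.2 q
    change P.1 (f * g) q = f • P.1 g q + g • P.1 f q
    simp only [← hD, D.leibniz]

/-- `[X, P] = L_X P`: the Lie derivative (Schouten bracket) of the bivector `P` along the vector
field `X`. -/
def lieDeriv (X : VectorField K R) (P : Bivector K R) : Bivector K R :=
  ⟨fun f g => X (P.1 f g) - P.1 (X f) g - P.1 f (X g), by
    refine ⟨fun f => ?_, fun f => ?_, fun g => ?_⟩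
    · change X (P.1 f f) - P.1 (X f) f - P.1 f (X f) = 0
      rw [P.2.1, map_zero, P.skew f (X f)]; ring
    · obtain ⟨D, hD⟩ := P.2.2.1 f
      obtain ⟨D', hD'⟩ := P.2.2.1 (X f)
      refine ⟨⁅X, D⁆ - D', fun g => ?_⟩
      simp only [Derivation.sub_apply, Derivation.commutator_apply, hD, hD']; ring
    · obtain ⟨D, hD⟩ := P.2.2.2 g
      obtain ⟨D', hD'⟩ := P.2.2.2 (X g)
      refine ⟨⁅X, D⁆ - D', fun f => ?_⟩
      simp only [Derivation.sub_apply, Derivation.commutator_apply, hD, hD']⟩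

/-- The Schouten bracket `[P, Z] = -[Z, P]` of a bivector `P` and a vector field `Z`. -/
def schoutenVF (P : Bivector K R) (Z : VectorField K R) : Bivector K R := -lieDeriv Z P

/-- The Schouten bracket `[P, Q]` of two bivectors, in the normalization determined by
`[X, f] = X f`, `[P, f] = ham P f` and the graded Leibniz rule (so that
`[P, x • Q] = ham P x ∧ Q + x • [P, Q]` for a function `x`). In particular, `[P, P]` is twice the
Jacobiator `P(f, P(g, h)) + P(g, P(h, f)) + P(h, P(f, g))`. -/
def schouten (P Q : Bivector K R) : Trivector K R :=
  ⟨fun f g h => (P.1 f (Q.1 g h) + P.1 g (Q.1 h f) + P.1 h (Q.1 f g)) +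
      (Q.1 f (P.1 g h) + Q.1 g (P.1 h f) + Q.1 h (P.1 f g)), by
    refine trivector_mem_of_cyclic _ (fun f g h => by ring) (fun f g => ?_) (fun g h => ?_)
    · obtain ⟨D, hD⟩ := P.2.2.1 g
      obtain ⟨D', hD'⟩ := Q.2.2.1 g
      obtain ⟨D1, hD1⟩ := P.2.2.1 f
      obtain ⟨D1', hD1'⟩ := Q.2.2.1 f
      have e1 : P.1 f (-Q.1 f g) = -P.1 f (Q.1 f g) := by rw [← hD1, map_neg, hD1]
      have e2 : Q.1 f (-P.1 f g) = -Q.1 f (P.1 f g) := by rw [← hD1', map_neg, hD1']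
      have e3 : P.1 g 0 = 0 := by rw [← hD, map_zero]
      have e4 : Q.1 g 0 = 0 := by rw [← hD', map_zero]
      change (P.1 f (Q.1 f g) + P.1 f (Q.1 g f) + P.1 g (Q.1 f f)) +
        (Q.1 f (P.1 f g) + Q.1 f (P.1 g f) + Q.1 g (P.1 f f)) = 0
      rw [Q.2.1, P.2.1, Q.skew g f, P.skew g f, e1, e2, e3, e4]
      ring
    · obtain ⟨A, hA⟩ := P.2.2.2 (Q.1 g h)
      obtain ⟨A', hA'⟩ := Q.2.2.2 (P.1 g h)
      obtain ⟨B, hB⟩ := P.2.2.1 g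
      obtain ⟨B', hB'⟩ := Q.2.2.1 g
      obtain ⟨C, hC⟩ := P.2.2.1 h
      obtain ⟨C', hC'⟩ := Q.2.2.1 h
      refine ⟨A + A' + ⁅B, C'⁆ + ⁅B', C⁆, fun f => ?_⟩
      simp only [Derivation.add_apply, Derivation.commutator_apply, hA, hA']
      rw [P.skew f g, Q.skew f g, ← hB f, ← hB' f, ← hC f, ← hC' f, ← hB (C' f), ← hB' (C f),
        ← hC (-B' f), ← hC' (-B f), map_neg, map_neg]
      ring⟩

/-- A bivector is Poisson if its Schouten square vanishes. -/
def IsPoisson (P : Bivector K R) : Prop := schouten P P = 0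

/-- The wedge product of two vector fields. -/
def wedge (X Y : VectorField K R) : Bivector K R :=
  ⟨fun f g => X f * Y g - X g * Y f, by
    refine ⟨fun f => by ring, fun f => ⟨X f • Y - Y f • X, fun g => ?_⟩,
      fun g => ⟨Y g • X - X g • Y, fun f => ?_⟩⟩ <;>
    · simp only [Derivation.sub_apply, Derivation.smul_apply, smul_eq_mul]; ring⟩

/-- The wedge product of a vector field and a bivector. -/
def wedgeBi (X : VectorField K R) (P : Bivector K R) : Trivector K R :=
  ⟨fun f g h => X f * P.1 g h + X g * P.1 h f + X h * P.1 f g, by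
    refine trivector_mem_of_cyclic _ (fun f g h => by ring) (fun f g => ?_) (fun g h => ?_)
    · rw [P.2.1, P.skew g f]; ring
    · obtain ⟨D, hD⟩ := P.2.2.1 h
      obtain ⟨D', hD'⟩ := P.2.2.2 g
      refine ⟨P.1 g h • X + X g • D + X h • D', fun f => ?_⟩
      simp only [Derivation.add_apply, Derivation.smul_apply, smul_eq_mul, hD, hD']; ring⟩

end Multiderivations

/-! Linear coordinates `σ` on a vector space: polynomial functions are `MvPolynomial σ K`. -/

section Coordinates

variable {K σ : Type*} [Field K]

/-- A vector field with homogeneous quadratic coefficients. -/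
def VectorField.IsQuadratic (X : VectorField K (MvPolynomial σ K)) : Prop :=
  ∀ i, (X (MvPolynomial.X i)).IsHomogeneous 2

/-- A bivector with homogeneous quadratic coefficients. -/
def Bivector.IsQuadratic (P : Bivector K (MvPolynomial σ K)) : Prop :=
  ∀ i j, (P.1 (X i) (X j)).IsHomogeneous 2

/-- `P|_a = 0`: the bivector vanishes at the point with coordinates `a`. -/
def Bivector.VanishesAt (P : Bivector K (MvPolynomial σ K)) (a : σ → K) : Prop :=
  ∀ f g, eval a (P.1 f g) = 0

/-- The constant vector field `T_a`, the generator of the translations `x ↦ x + t a`. -/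
def translationField (a : σ → K) : VectorField K (MvPolynomial σ K) :=
  mkDerivation K fun i => C (a i)

/-- The linearization `[T_a, P]` at `a` of a quadratic bivector `P`. -/
def linearization (a : σ → K) (P : Bivector K (MvPolynomial σ K)) :
    Bivector K (MvPolynomial σ K) :=
  lieDeriv (translationField a) P

end Coordinates

section LiePoisson

variable {K L σ : Type*} [Field K] [LieRing L] [LieAlgebra K L] [Fintype σ]

/-- An element `y` of `L`, as a linear function on the dual space `L*`, in the linear coordinates
on `L*` given by a basis `B` of `L`. -/
def linFun (B : Module.Basis σ K L) (y : L) : MvPolynomial σ K :=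
  ∑ k, C (B.repr y k) * X k

theorem linFun_neg (B : Module.Basis σ K L) (y : L) : linFun B (-y) = -linFun B y := by
  simp [linFun]

/-- The canonical Lie--Poisson bivector on `L*`, in the linear coordinates given by a basis `B` of
`L`: `π₁(f, g) = ∑ i j, ∂f/∂x_i ∂g/∂x_j [B i, B j]`. -/
def liePoisson (B : Module.Basis σ K L) : Bivector K (MvPolynomial σ K) :=
  ⟨fun f g => ∑ i, ∑ j, pderiv i f * pderiv j g * linFun B ⁅B i, B j⁆, by
    have hs : ∀ f g : MvPolynomial σ K,
        ∑ i, ∑ j, pderiv i f * pderiv j g * linFun B ⁅B i, B j⁆ =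
          -∑ i, ∑ j, pderiv i g * pderiv j f * linFun B ⁅B i, B j⁆ := by
      intro f g
      rw [Finset.sum_comm, ← Finset.sum_neg_distrib]
      refine Finset.sum_congr rfl fun i _ => ?_
      rw [← Finset.sum_neg_distrib]
      refine Finset.sum_congr rfl fun j _ => ?_
      rw [← lie_skew, linFun_neg]
      ring
    have hd : ∀ f : MvPolynomial σ K, ∃ D : Derivation K (MvPolynomial σ K) (MvPolynomial σ K),
        ∀ g, D g = ∑ i, ∑ j, pderiv i f * pderiv j g * linFun B ⁅B i, B j⁆ := fun f =>
      ⟨∑ i, ∑ j, (pderiv i f * linFun B ⁅B i, B j⁆) • pderiv j, fun g => by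
        have hsum : ∀ (t : Finset σ) (G : σ → Derivation K (MvPolynomial σ K) (MvPolynomial σ K)),
            (∑ i ∈ t, G i) g = ∑ i ∈ t, G i g := fun t G => by
          classical
          induction t using Finset.induction_on with
          | empty => simp
          | insert i t hi ih => simp [Finset.sum_insert hi, ih]
        simp only [hsum, Derivation.smul_apply, smul_eq_mul]
        refine Finset.sum_congr rfl fun i _ => Finset.sum_congr rfl fun j _ => ?_
        ring⟩
    refine ⟨fun f => ?_, hd, fun g => ?_⟩
    · classical
      change ∑ i, ∑ j, pderiv i f * pderiv j f * linFun B ⁅B i, B j⁆ = 0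
      rw [← Finset.sum_product']
      refine Finset.sum_involution (fun p _ => (p.2, p.1)) (fun p _ => ?_) (fun p _ hp he => ?_)
        (fun p _ => by simp) (fun p _ => by simp)
      · simp only
        rw [← lie_skew (B p.1), linFun_neg]
        ring
      · have : p.2 = p.1 := congrArg Prod.fst he
        apply hp
        rw [this, lie_self]
        simp [linFun]
    · obtain ⟨D, hD⟩ := hd g
      exact ⟨-D, fun f => by rw [Derivation.neg_apply, hD]; exact (hs f g).symm⟩⟩

end LiePoisson

/-! The trivial central extension `g = s ⊕ K`, realised as the product Lie algebra `s × K`, where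
the bracket of the second factor vanishes. A point `a ∈ K* ⊂ g* = s* ⊕ K*` is a linear form on
`s × K` that vanishes on `s`. The coordinates on `s*` are indexed by `ι`, those on `g*` by
`Option ι`, with `none` standing for `x₀`. -/

section Extension

variable {K s ι : Type*} [Field K] [LieRing s] [LieAlgebra K s]

theorem central_ne_zero {a : Module.Dual K (s × K)} (ha : a ≠ 0) (has : ∀ y : s, a (y, 0) = 0) :
    a (0, 1) ≠ 0 := by
  intro h
  apply ha
  ext y
  · simpa using has y
  · simpa using h

/-- The linear coordinates on `g*` adapted to `a`, as elements of `g = (g*)*`: the elements `b i`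
of a basis of `s`, and the central element `x₀ = (0, z)` with `x₀(a) = 1`. -/
def adaptedBasis (b : Module.Basis ι K s) (a : Module.Dual K (s × K)) (ha : a ≠ 0)
    (has : ∀ y : s, a (y, 0) = 0) : Module.Basis (Option ι) K (s × K) :=
  (b.prod ((Module.Basis.singleton PUnit.{1} K).isUnitSMul (w := fun _ => (a (0, 1))⁻¹)
    fun _ => (isUnit_iff_ne_zero.2 (inv_ne_zero (central_ne_zero ha has))))).reindex
      (Equiv.optionEquivSumPUnit ι).symm

theorem adaptedBasis_some (b : Module.Basis ι K s) (a : Module.Dual K (s × K)) (ha : a ≠ 0)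
    (has : ∀ y : s, a (y, 0) = 0) (i : ι) : adaptedBasis b a ha has (some i) = (b i, 0) := by
  simp [adaptedBasis]

theorem adaptedBasis_none (b : Module.Basis ι K s) (a : Module.Dual K (s × K)) (ha : a ≠ 0)
    (has : ∀ y : s, a (y, 0) = 0) :
    adaptedBasis b a ha has none = (0, (a (0, 1))⁻¹) := by
  simp [adaptedBasis, Module.Basis.isUnitSMul_apply]

/-- `P` is a centrally linearizable quadratic Poisson bivector on `g*`, with respect to the point
`a ∈ K* ⊂ g*`, `a ≠ 0`; everything is written in the linear coordinates on `g*` given by a basis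
`B` of `g`. -/
structure IsCLAt {σ : Type*} [Fintype σ] (B : Module.Basis σ K (s × K))
    (a : Module.Dual K (s × K)) (P : Bivector K (MvPolynomial σ K)) : Prop where
  quadratic : P.IsQuadratic
  poisson : IsPoisson P
  ne_zero : a ≠ 0
  central : ∀ y : s, a (y, 0) = 0
  vanishes : P.VanishesAt fun i => a (B i)
  linearization_eq : linearization (fun i => a (B i)) P = liePoisson (L := s × K) B

/-- A function on `s*`, treated as a function on `g*` independent of `x₀`. -/
def extFun (q : MvPolynomial ι K) : MvPolynomial (Option ι) K := rename some q

/-- A vector field on `s*`, treated as a vector field on `g*`: its coefficients do not depend on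
`x₀` and its `∂/∂x₀`-component is zero. -/
def extField (Y : VectorField K (MvPolynomial ι K)) : VectorField K (MvPolynomial (Option ι) K) :=
  mkDerivation K fun i => i.elim 0 fun j => extFun (Y (X j))

/-- The Euler vector field `E = ∑ x_i ∂/∂x_i` on `s*`. -/
def euler : VectorField K (MvPolynomial ι K) := mkDerivation K X

/-- The vector field `X + q ∂/∂x₀ - x₀ E` on `g*`, for a vector field `X` and a function `q` on
`s*`. -/
def tildeField (Y : VectorField K (MvPolynomial ι K)) (q : MvPolynomial ι K) :
    VectorField K (MvPolynomial (Option ι) K) :=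
  extField Y + extFun q • pderiv none - (X none : MvPolynomial (Option ι) K) • extField euler

/-- The two basic identities `[π, π] = 2 π₁(q) ∧ π₁` and `[π, π₁(q)] = 0`, where `π = [X, π₁]`. -/
def BasicIdentities {R : Type*} [CommRing R] [Algebra K R] (π₁ : Bivector K R)
    (Y : VectorField K R) (q : R) : Prop :=
  schouten (lieDeriv Y π₁) (lieDeriv Y π₁) = (2 : R) • wedgeBi (ham π₁ q) π₁ ∧
    schoutenVF (lieDeriv Y π₁) (ham π₁ q) = 0

end Extension

end CLPoisson

end

open CLPoisson

/-! Since $[\partial/\partial x_0,\pi_2]=\pi_1$ and $x_0$ is central, the components of $\pi_2$ are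
affine in $x_0$: on functions of $\mathfrak s^*$ it is $\pi+x_0\pi_1$, and paired with $x_0$ it is a
quadratic vector field $-V$, with $\pi$ and $V$ independent of $x_0$. Separating $[\pi_2,\pi_2]=0$
by powers of $x_0$ and by whether $x_0$ fills a slot gives four equations:
$[\pi,\pi]=2V\wedge\pi_1$, $[\pi,\pi_1]=0$, $\mathcal L_V\pi=0$ and $\mathcal L_V\pi_1=0$
(`isPoisson_iff_of_decomposition`).

Restricted to linear functions, $V$ and $\pi$ are a 1-cocycle and a 2-cocycle of $\mathfrak s$ with
values in quadratic polynomials, by the equations involving only $\pi_1$. The Whitehead lemmas make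
them coboundaries: $V=\pi_1(q)$ and $\pi=[X,\pi_1]$. Conversely, for such $V$ and $\pi$ these two
equations follow from the Jacobi identity, and the other two are the basic identities. The term
$-x_0E$ of $\widetilde X$ produces $x_0\pi_1$ because $\mathcal L_E\pi_1=-\pi_1$.

The Whitehead lemmas (`vanishingOne`, `vanishingTwo`) are proved over any field of characteristic
zero, by dévissage to modules that are trivial or carry an invertible Casimir operator. To avoid
extending scalars, the Casimir operator is twisted by an element of the centroid, chosen so that its
trace is nonzero (`exists_centroid_trace_mul_ne_zero`). -/

namespace LieAlgebra

/-! ### The centroid and perfectness of a Killing Lie algebra. -/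

section Centroid

variable {K L : Type*} [Field K] [LieRing L] [LieAlgebra K L]

/-- The centroid of a Lie algebra: the endomorphisms which commute with the adjoint action. -/
def centroid (K L : Type*) [Field K] [LieRing L] [LieAlgebra K L] :
    Subalgebra K (Module.End K L) where
  carrier := {T | ∀ x y : L, T ⁅x, y⁆ = ⁅x, T y⁆}
  mul_mem' {S T} hS hT x y := by simp [hT x y, hS x (T y)]
  add_mem' {S T} hS hT x y := by simp [hT x y, hS x y]
  algebraMap_mem' c x y := by simp [Module.algebraMap_end_apply]

theorem mem_centroid {T : Module.End K L} : T ∈ centroid K L ↔ ∀ x y : L, T ⁅x, y⁆ = ⁅x, T y⁆ :=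
  Iff.rfl

variable [IsKilling K L]

theorem eq_zero_of_killingForm_eq_zero {x : L} (h : ∀ y, killingForm K L x y = 0) : x = 0 := by
  have h1 : x ∈ LinearMap.ker (killingForm K L) := by
    rw [LinearMap.mem_ker]; ext y; simpa using h y
  rwa [IsKilling.ker_killingForm_eq_bot, Submodule.mem_bot] at h1

/-- Here $\operatorname{ad}(Sx)\operatorname{ad}y=S\operatorname{ad}x\operatorname{ad}y$ with
commuting factors $S$ and $\operatorname{ad}x\operatorname{ad}y$. This is nilpotent, so $Sx$ is
Killing-orthogonal to everything. -/
theorem centroid_eq_zero_of_isNilpotent {S : Module.End K L} (hS : S ∈ centroid K L)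
    (hn : IsNilpotent S) : S = 0 := by
  ext x
  refine eq_zero_of_killingForm_eq_zero (K := K) fun y => ?_
  have h1 : ad K L (S x) ∘ₗ ad K L y = S * (ad K L x * ad K L y) := by
    ext z
    simp only [LinearMap.comp_apply, ad_apply, Module.End.mul_apply]
    rw [← lie_skew, ← mem_centroid.1 hS, ← map_neg, lie_skew]
  have h2 : Commute S (ad K L x * ad K L y) := by
    refine LinearMap.ext fun z => ?_
    simp [mem_centroid.1 hS]
  rw [killingForm_apply_apply, h1]
  exact (LinearMap.isNilpotent_trace_of_isNilpotent (h2.isNilpotent_mul_right hn)).eq_zero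

variable [FiniteDimensional K L]

/-- The algebra $K[T]$ has no nilpotents, so a Bézout identity supplies $S\in K[T]$ with $TS$ a
nonzero idempotent; its trace is nonzero in characteristic zero. -/
theorem exists_centroid_trace_mul_ne_zero [CharZero K] {T : Module.End K L}
    (hT : T ∈ centroid K L) (h0 : T ≠ 0) :
    ∃ S ∈ centroid K L, LinearMap.trace K L (T * S) ≠ 0 := by
  have hmem : ∀ p : Polynomial K, Polynomial.aeval T p ∈ centroid K L := fun p =>
    Algebra.adjoin_le (by simpa using hT) (Polynomial.aeval_mem_adjoin_singleton K T)
  have hm : minpoly K T ≠ 0 := minpoly.ne_zero (Algebra.IsIntegral.isIntegral T)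
  obtain ⟨g, hg, hgX⟩ := Polynomial.exists_eq_pow_rootMultiplicity_mul_and_not_dvd
    (minpoly K T) hm 0
  set n := Polynomial.rootMultiplicity 0 (minpoly K T)
  rw [map_zero, sub_zero] at hg hgX
  obtain ⟨u, v, huv⟩ := (Polynomial.irreducible_X.coprime_iff_not_dvd).2 hgX
  -- The minimal polynomial is $X^ng$, so the power $n+1$ of $Xvg$ is a multiple of it, including
  -- when $n=0$.
  have hnil : Polynomial.aeval T (Polynomial.X * (v * g)) = 0 := by
    refine centroid_eq_zero_of_isNilpotent (hmem _) ⟨n + 1, ?_⟩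
    have : (Polynomial.X * (v * g)) ^ (n + 1) =
        (Polynomial.X * v ^ (n + 1) * g ^ n) * minpoly K T := by
      rw [hg]; ring
    rw [← map_pow, this, map_mul, minpoly.aeval, mul_zero]
  refine ⟨Polynomial.aeval T u, hmem u, fun htr => h0 ?_⟩
  have he : T * Polynomial.aeval T u = Polynomial.aeval T (Polynomial.X * u) := by simp
  rw [he] at htr
  have hid : IsIdempotentElem (Polynomial.aeval T (Polynomial.X * u)) := by
    change _ * _ = _
    rw [← map_mul]
    have : Polynomial.X * u * (Polynomial.X * u) =
        Polynomial.X * u - u * (Polynomial.X * (v * g)) := by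
      linear_combination (Polynomial.X * u) * huv
    rw [this, map_sub, map_mul _ u, hnil, mul_zero, sub_zero]
  have hz := LinearMap.IsIdempotentElem.eq_zero_of_trace_eq_zero hid htr
  -- Multiplying $uX+vg=1$ by $X$ expresses $T$ through $Tu(T)$ and $Tv(T)g(T)$, both zero.
  have : (Polynomial.X : Polynomial K) =
      Polynomial.X * (Polynomial.X * u) + Polynomial.X * (v * g) := by
    linear_combination (-Polynomial.X) * huv
  have h2 := congrArg (Polynomial.aeval T) this
  rwa [map_add, hnil, map_mul, hz, Polynomial.aeval_X, mul_zero, add_zero] at h2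

variable (K L) in
-- A functional killing $[L,L]$ is $\kappa(x,\cdot)$ for some $x$; invariance of $\kappa$ makes $x$
-- central, hence $\operatorname{ad}x=0$ and $x=0$.
theorem derivedSeries_one_eq_top : derivedSeries K L 1 = ⊤ := by
  by_contra hne
  have hlt : (derivedSeries K L 1).toSubmodule < ⊤ := by
    rw [lt_top_iff_ne_top]
    intro h
    exact hne (by simpa using h)
  obtain ⟨f, hf0, hf⟩ := Submodule.exists_le_ker_of_lt_top _ hlt
  let e := LinearMap.BilinForm.toDual (killingForm K L) (IsKilling.killingForm_nondegenerate K L)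
  obtain ⟨x, rfl⟩ := e.surjective f
  have hx : ∀ y z : L, killingForm K L x ⁅y, z⁆ = 0 := fun y z => by
    have : ⁅y, z⁆ ∈ (derivedSeries K L 1).toSubmodule := by
      change _ ∈ derivedSeries K L 1
      rw [derivedSeries_def, derivedSeriesOfIdeal_succ, derivedSeriesOfIdeal_zero]
      exact LieSubmodule.lie_mem_lie (LieSubmodule.mem_top y) (LieSubmodule.mem_top z)
    exact hf this
  have hxy : ∀ y : L, ⁅x, y⁆ = 0 := fun y => eq_zero_of_killingForm_eq_zero (K := K) fun z => by
    rw [LieModule.traceForm_apply_lie_apply]; exact hx y z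
  have hx0 : x = 0 := eq_zero_of_killingForm_eq_zero (K := K) fun y => by
    have : ad K L x = 0 := by ext z; simpa using hxy z
    rw [killingForm_apply_apply, this]; simp
  exact hf0 (by simp [hx0])

theorem induction_lie_mem {p : L → Prop} (h0 : p 0) (hadd : ∀ x y, p x → p y → p (x + y))
    (hsmul : ∀ (c : K) x, p x → p (c • x)) (hlie : ∀ x y : L, p ⁅x, y⁆) (x : L) : p x := by
  have hx : x ∈ derivedSeries K L 1 := by rw [derivedSeries_one_eq_top]; trivial
  rw [derivedSeries_def, derivedSeriesOfIdeal_succ, derivedSeriesOfIdeal_zero,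
    ← LieSubmodule.mem_toSubmodule, LieSubmodule.lieIdeal_oper_eq_linear_span'] at hx
  induction hx using Submodule.span_induction with
  | mem x hx => obtain ⟨y, -, z, -, rfl⟩ := hx; exact hlie y z
  | zero => exact h0
  | add x y _ _ hx hy => exact hadd x y hx hy
  | smul c x _ hx => exact hsmul c x hx

end Centroid

end LieAlgebra

/-! ### Casimir operators twisted by the centroid. -/

namespace LieModule

open LieAlgebra

variable {K L M : Type*} [Field K] [LieRing L] [LieAlgebra K L]
  [IsKilling K L] [AddCommGroup M] [Module K M] [LieRingModule L M] [LieModule K L M]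

section Casimir

variable {κ : Type*} [Fintype κ] [DecidableEq κ] (e : Module.Basis κ K L)

/-- The basis dual to `e` with respect to the Killing form. -/
noncomputable def killingDual : Module.Basis κ K L :=
  LinearMap.BilinForm.dualBasis (killingForm K L) (IsKilling.killingForm_nondegenerate K L) e

theorem killingForm_killingDual (i : κ) (x : L) :
    killingForm K L (killingDual e i) x = e.repr x i := by
  have : killingForm K L (killingDual e i) = e.coord i := e.ext fun j => by
    rw [killingDual, LinearMap.BilinForm.apply_dualBasis_left, e.coord_apply, e.repr_self,
      Finsupp.single_apply]
  rw [this, e.coord_apply]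

theorem sum_killingForm_smul (x : L) : ∑ i, killingForm K L (killingDual e i) x • e i = x := by
  simp only [killingForm_killingDual, e.sum_repr]

theorem sum_killingForm_smul_killingDual (x : L) :
    ∑ i, killingForm K L x (e i) • killingDual e i = x := by
  conv_rhs => rw [← (killingDual e).sum_repr x]
  simp only [killingDual, LinearMap.BilinForm.dualBasis_repr_apply]

theorem trace_eq_sum_killingForm (A : Module.End K L) :
    LinearMap.trace K L A = ∑ i, killingForm K L (A (e i)) (killingDual e i) := by
  rw [LinearMap.trace_eq_matrix_trace K e, Matrix.trace]
  refine Finset.sum_congr rfl fun i _ => ?_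
  rw [Matrix.diag_apply, LinearMap.toMatrix_apply, LieModule.traceForm_comm,
    killingForm_killingDual]

/-- Invariance of the tensor `∑ i, S (e i) ⊗ e' i` for `S` in the centroid. -/
theorem sum_lie_killingDual {S : Module.End K L} (hS : S ∈ centroid K L) {N : Type*}
    [AddCommGroup N] [Module K N] (β : L →ₗ[K] L →ₗ[K] N) (x : L) :
    ∑ i, β ⁅x, S (e i)⁆ (killingDual e i) = -∑ i, β (S (e i)) ⁅x, killingDual e i⁆ := by
  have h1 : ∀ i, ⁅x, e i⁆ = ∑ j, killingForm K L (killingDual e j) ⁅x, e i⁆ • e j :=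
    fun i => (sum_killingForm_smul e _).symm
  have h2 : ∀ i, ⁅x, killingDual e i⁆ =
      ∑ j, killingForm K L ⁅x, killingDual e i⁆ (e j) • killingDual e j :=
    fun i => (sum_killingForm_smul_killingDual e _).symm
  -- The matrices of $\operatorname{ad}x$ in dual bases are negative transposes of each other.
  have h3 : ∀ i j, killingForm K L ⁅x, killingDual e i⁆ (e j) =
      -killingForm K L (killingDual e i) ⁅x, e j⁆ := fun i j => by
    rw [LieModule.traceForm_apply_lie_apply']
  have hl : ∀ i, β ⁅x, S (e i)⁆ (killingDual e i) =
      ∑ j, killingForm K L (killingDual e j) ⁅x, e i⁆ • β (S (e j)) (killingDual e i) :=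
    fun i => by
      conv_lhs => rw [← mem_centroid.1 hS, h1 i]
      simp only [map_sum, map_smul, LinearMap.sum_apply, LinearMap.smul_apply]
  have hr : ∀ i, β (S (e i)) ⁅x, killingDual e i⁆ =
      -∑ j, killingForm K L (killingDual e i) ⁅x, e j⁆ • β (S (e i)) (killingDual e j) :=
    fun i => by
      rw [h2 i]
      simp [h3]
  simp only [hl, hr, Finset.sum_neg_distrib, neg_neg]
  exact Finset.sum_comm

variable (M) in
/-- The Casimir operator `∑ i, S (e i) * e' i` of a module, twisted by an endomorphism `S`. -/
noncomputable def casimir (S : Module.End K L) : Module.End K M :=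
  ∑ i, toEnd K L M (S (e i)) * toEnd K L M (killingDual e i)

theorem casimir_apply (S : Module.End K L) (m : M) :
    casimir M e S m = ∑ i, ⁅S (e i), ⁅killingDual e i, m⁆⁆ := by
  simp [casimir]

theorem casimir_lie {S : Module.End K L} (hS : S ∈ centroid K L) (x : L) (m : M) :
    casimir M e S ⁅x, m⁆ = ⁅x, casimir M e S m⁆ := by
  have h := sum_lie_killingDual e hS
    (LinearMap.mk₂ K (fun y z : L => ⁅y, ⁅z, m⁆⁆) (by simp) (by simp) (by simp) (by simp)) x
  simp only [LinearMap.mk₂_apply] at h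
  simp only [casimir_apply, lie_sum]
  have : ∀ i, ⁅x, ⁅S (e i), ⁅killingDual e i, m⁆⁆⁆ = ⁅⁅x, S (e i)⁆, ⁅killingDual e i, m⁆⁆ +
      ⁅S (e i), ⁅⁅x, killingDual e i⁆, m⁆⁆ + ⁅S (e i), ⁅killingDual e i, ⁅x, m⁆⁆⁆ := fun i => by
    rw [leibniz_lie x, leibniz_lie x, lie_add, add_assoc]
  simp only [this, Finset.sum_add_distrib, h]
  abel

/-- Each summand has trace $\kappa(TSe_i,e'_i)$, and these add up to the trace of $TS$ on $L$. -/
theorem trace_casimir (S T : Module.End K L)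
    (hT : ∀ x y, killingForm K L (T x) y = traceForm K L M x y) :
    LinearMap.trace K M (casimir M e S) = LinearMap.trace K L (T * S) := by
  rw [trace_eq_sum_killingForm e, casimir, map_sum]
  refine Finset.sum_congr rfl fun i _ => ?_
  rw [Module.End.mul_apply, hT]
  rfl

end Casimir

variable [FiniteDimensional K L]

variable (K L M) in
/-- A module on which the trace form is nonzero admits a Casimir operator of nonzero trace. -/
theorem exists_casimir_ne_zero [CharZero K] (h : traceForm K L M ≠ 0) :
    ∃ S ∈ centroid K L, casimir M (Module.finBasis K L) S ≠ 0 := by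
  let k := LinearMap.BilinForm.toDual (killingForm K L) (IsKilling.killingForm_nondegenerate K L)
  let T : Module.End K L := k.symm.toLinearMap ∘ₗ traceForm K L M
  have hT : ∀ x y, killingForm K L (T x) y = traceForm K L M x y := fun x y => by
    have : k (T x) = traceForm K L M x := by simp [T]
    rw [← this]; rfl
  -- `T` converts the Killing form into the trace form of `M`; invariance of both forms puts it in
  -- the centroid.
  have hTc : T ∈ centroid K L := fun x y => by
    rw [← sub_eq_zero]
    refine eq_zero_of_killingForm_eq_zero (K := K) fun z => ?_
    rw [map_sub, LinearMap.sub_apply, hT, LieModule.traceForm_apply_lie_apply',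
      LieModule.traceForm_apply_lie_apply', hT, sub_self]
  have hT0 : T ≠ 0 := fun h0 => h <| by
    ext x y
    rw [← hT, h0]; simp
  obtain ⟨S, hS, htr⟩ := exists_centroid_trace_mul_ne_zero hTc hT0
  refine ⟨S, hS, fun h0 => htr ?_⟩
  rw [← trace_casimir (Module.finBasis K L) S T hT, h0, map_zero]

/-- If the trace form of a nontrivial module vanishes, there are nonzero invariants. -/
theorem maxTrivSubmodule_ne_bot_of_traceForm_eq_zero [CharZero K] [FiniteDimensional K M]
    [Nontrivial M] (h : traceForm K L M = 0) : maxTrivSubmodule K L M ≠ ⊥ := by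
  -- The derived algebra acts nilpotently, so it has nonzero invariants; it is all of `L` by
  -- perfectness.
  have := isNilpotent_derivedSeries_of_traceForm_eq_zero h
  have hn := nontrivial_max_triv_of_isNilpotent K (derivedSeries K L 1) M
  obtain ⟨⟨m, hm⟩, hm0⟩ := exists_ne (0 : maxTrivSubmodule K (derivedSeries K L 1) M)
  intro hb
  apply hm0
  ext
  have : m ∈ maxTrivSubmodule K L M := fun x =>
    hm ⟨x, by rw [derivedSeries_one_eq_top]; trivial⟩
  rw [hb] at this
  simpa using this

end LieModule

/-! ### Cocycles in degrees one and two, and the Whitehead lemmas. -/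

namespace LieModule

open LieAlgebra

variable {K L M : Type*} [Field K] [LieRing L] [LieAlgebra K L]
  [AddCommGroup M] [Module K M] [LieRingModule L M]

/-- The 1-cocycle condition. -/
def IsOneCocycle (c : L →ₗ[K] M) : Prop := ∀ x y : L, c ⁅x, y⁆ = ⁅x, c y⁆ - ⁅y, c x⁆

/-- The 2-cocycle condition. -/
structure IsTwoCocycle (ω : L →ₗ[K] L →ₗ[K] M) : Prop where
  alt : ∀ x, ω x x = 0
  closed : ∀ x y z : L, ⁅x, ω y z⁆ + ⁅y, ω z x⁆ + ⁅z, ω x y⁆ + ω x ⁅y, z⁆ + ω y ⁅z, x⁆ +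
    ω z ⁅x, y⁆ = 0

theorem IsTwoCocycle.skew {ω : L →ₗ[K] L →ₗ[K] M} (h : IsTwoCocycle ω) (x y : L) :
    ω x y = -ω y x := by
  have := h.alt (x + y)
  simp only [map_add, LinearMap.add_apply, h.alt, zero_add, add_zero] at this
  rw [add_comm] at this
  exact eq_neg_of_add_eq_zero_left this

variable [LieModule K L M]

/-- The coboundary of a linear map, as a bilinear map. -/
def coboundary (η : L →ₗ[K] M) : L →ₗ[K] L →ₗ[K] M :=
  LinearMap.mk₂ K (fun x y => ⁅x, η y⁆ - ⁅y, η x⁆ - η ⁅x, y⁆)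
    (fun x x' y => by simp; abel) (fun c x y => by simp [smul_sub])
    (fun x y y' => by simp; abel) (fun c x y => by simp [smul_sub])

@[simp]
theorem coboundary_apply (η : L →ₗ[K] M) (x y : L) :
    coboundary η x y = ⁅x, η y⁆ - ⁅y, η x⁆ - η ⁅x, y⁆ := rfl

theorem coboundary_add (η ζ : L →ₗ[K] M) : coboundary (η + ζ) = coboundary η + coboundary ζ := by
  ext x y; simp; abel

theorem isTwoCocycle_coboundary (η : L →ₗ[K] M) : IsTwoCocycle (coboundary η) where
  alt x := by simp
  closed x y z := by
    have hJ := congrArg η (lie_jacobi x y z)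
    simp only [map_add, map_zero] at hJ
    simp only [coboundary_apply, lie_sub, lie_lie]
    rw [← neg_eq_zero.2 hJ]
    abel

omit [LieModule K L M] in
theorem IsTwoCocycle.sub {ω ω' : L →ₗ[K] L →ₗ[K] M} (h : IsTwoCocycle ω)
    (h' : IsTwoCocycle ω') : IsTwoCocycle (ω - ω') where
  alt x := by simp [h.alt, h'.alt]
  closed x y z := by
    have h1 := h.closed x y z
    have h2 := h'.closed x y z
    simp only [LinearMap.sub_apply, lie_sub]
    rw [← sub_eq_zero.2 (h1.trans h2.symm)]
    abel

omit [LieAlgebra K L] [LieModule K L M] in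
theorem linearEquiv_symm_lie (C : M ≃ₗ[K] M) (hC : ∀ (x : L) m, C ⁅x, m⁆ = ⁅x, C m⁆) (x : L)
    (m : M) : C.symm ⁅x, m⁆ = ⁅x, C.symm m⁆ := by
  rw [LinearEquiv.symm_apply_eq, hC, LinearEquiv.apply_symm_apply]

omit [LieAlgebra K L] [LieModule K L M] in
theorem _root_.LieSubmodule.finrank_quotient_lt [FiniteDimensional K M] {N : LieSubmodule K L M}
    (hN : N ≠ ⊥) : Module.finrank K (M ⧸ N) < Module.finrank K M := by
  have h1 := Submodule.finrank_quotient_add_finrank N.toSubmodule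
  have h2 : 0 < Module.finrank K N.toSubmodule := by
    rw [Module.finrank_pos_iff, Submodule.nontrivial_iff_ne_bot]
    simpa using hN
  have h3 : Module.finrank K (M ⧸ N) = Module.finrank K (M ⧸ N.toSubmodule) := rfl
  omega

variable (K L M) in
/-- Vanishing of the first cohomology. -/
def VanishingOne : Prop := ∀ c : L →ₗ[K] M, IsOneCocycle c → ∃ m : M, ∀ x : L, c x = ⁅x, m⁆

variable (K L M) in
/-- Vanishing of the second cohomology. -/
def VanishingTwo : Prop := ∀ ω : L →ₗ[K] L →ₗ[K] M, IsTwoCocycle ω → ∃ η, ω = coboundary η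

theorem VanishingOne.of_exact {Q : Type*} [AddCommGroup Q] [Module K Q] [LieRingModule L Q]
    [LieModule K L Q] {N : LieSubmodule K L M} (p : M →ₗ⁅K,L⁆ Q) (hp : Function.Surjective p)
    (hpN : ∀ m, p m = 0 ↔ m ∈ N) (hN : VanishingOne K L N) (hQ : VanishingOne K L Q) :
    VanishingOne K L M := by
  intro c hc
  obtain ⟨m', hm'⟩ := hQ ((p : M →ₗ[K] Q) ∘ₗ c) fun x y => by simp [hc x y]
  obtain ⟨m, rfl⟩ := hp m'
  have hmem : ∀ x, c x - ⁅x, m⁆ ∈ N := fun x => by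
    have := hm' x
    simp only [LinearMap.coe_comp, Function.comp_apply, LieModuleHom.coe_toLinearMap] at this
    rw [← hpN]
    simp [this]
  let c' : L →ₗ[K] N :=
    { toFun := fun x => ⟨c x - ⁅x, m⁆, hmem x⟩
      map_add' := fun x y => by ext; simp; abel
      map_smul' := fun a x => by ext; simp [smul_sub] }
  obtain ⟨n, hn⟩ := hN c' fun x y => by
    ext
    simp only [c', LinearMap.coe_mk, AddHom.coe_mk, LieSubmodule.coe_sub, LieSubmodule.coe_bracket,
      hc x y, lie_sub, lie_lie]
    abel
  refine ⟨m + n, fun x => ?_⟩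
  have h : c x - ⁅x, m⁆ = ⁅x, (n : M)⁆ := congrArg Subtype.val (hn x)
  rw [lie_add, ← h]
  abel

theorem VanishingTwo.of_exact {Q : Type*} [AddCommGroup Q] [Module K Q] [LieRingModule L Q]
    [LieModule K L Q] {N : LieSubmodule K L M} (p : M →ₗ⁅K,L⁆ Q) (hp : Function.Surjective p)
    (hpN : ∀ m, p m = 0 ↔ m ∈ N) (hN : VanishingTwo K L N) (hQ : VanishingTwo K L Q) :
    VanishingTwo K L M := by
  intro ω hω
  obtain ⟨η', hη'⟩ := hQ (ω.compr₂ (p : M →ₗ[K] Q))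
    ⟨fun x => by simp [hω.alt], fun x y z => by
      have := congrArg p (hω.closed x y z)
      simpa using this⟩
  -- A merely linear section suffices: it lifts the primitive from `Q`, and subtracting its
  -- coboundary leaves a cocycle with values in `N`.
  obtain ⟨r, hr⟩ := (p : M →ₗ[K] Q).exists_rightInverse_of_surjective (LinearMap.range_eq_top.2 hp)
  have hr' : ∀ q, p (r q) = q := LinearMap.congr_fun hr
  let ω' := ω - coboundary (r ∘ₗ η')
  have hω' : IsTwoCocycle ω' := hω.sub (isTwoCocycle_coboundary _)
  have hmem : ∀ x y, ω' x y ∈ N.toSubmodule := fun x y => by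
    rw [LieSubmodule.mem_toSubmodule, ← hpN]
    have := LinearMap.congr_fun₂ hη' x y
    simp only [LinearMap.compr₂_apply, LieModuleHom.coe_toLinearMap, coboundary_apply] at this
    simp [ω', this, hr']
  let ζ : L →ₗ[K] L →ₗ[K] N := LinearMap.mk₂ K (fun x y => ⟨ω' x y, hmem x y⟩)
    (fun x x' y => by ext; simp) (fun c x y => by ext; simp)
    (fun x y y' => by ext; simp) (fun c x y => by ext; simp)
  obtain ⟨θ, hθ⟩ := hN ζ ⟨fun x => by ext; simp [ζ, hω'.alt], fun x y z => by
    ext; simpa [ζ] using hω'.closed x y z⟩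
  refine ⟨r ∘ₗ η' + N.toSubmodule.subtype ∘ₗ θ, ?_⟩
  rw [coboundary_add, ← sub_eq_iff_eq_add']
  ext x y
  have h := congrArg Subtype.val (LinearMap.congr_fun₂ hθ x y)
  simpa [ζ, ω'] using h

/-- The second cohomology embeds in the first cohomology with coefficients in `L →ₗ[K] M`, when
the action on `M` is trivial. -/
theorem VanishingTwo.of_isTrivial (htriv : ∀ (x : L) (m : M), ⁅x, m⁆ = 0)
    (h : VanishingOne K L (L →ₗ[K] M)) : VanishingTwo K L M := by
  intro ω hω
  -- With trivial action on `M`, currying turns the 2-cocycle into a 1-cocycle with values in `L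
  -- →ₗ[K] M`, and $(x\cdot\varphi)(y)=-\varphi([x,y])$ is the coboundary of $\varphi$.
  obtain ⟨φ, hφ⟩ := h ω fun x y => by
    ext z
    have := hω.closed x y z
    simp only [htriv, zero_add] at this
    simp only [LinearMap.sub_apply, LieHom.lie_apply, htriv, zero_sub]
    rw [hω.skew ⁅x, y⁆, ← sub_eq_zero, ← neg_eq_zero.2 this, ← lie_skew x z, map_neg]
    abel
  refine ⟨φ, ?_⟩
  ext x y
  rw [hφ]
  simp [htriv]

section Casimir

variable [IsKilling K L] {κ : Type*} [Fintype κ] [DecidableEq κ] (e : Module.Basis κ K L)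

/-- Contracting the cocycle with the invariant tensor $\sum_i Se_i\otimes e'_i$ is a homotopy
between the Casimir operator and zero; when the Casimir operator is invertible, every cocycle
becomes a coboundary. -/
theorem casimir_apply_oneCocycle {S : Module.End K L} (hS : S ∈ centroid K L) {c : L →ₗ[K] M}
    (hc : IsOneCocycle c) (x : L) :
    casimir M e S (c x) = ⁅x, ∑ i, ⁅S (e i), c (killingDual e i)⁆⁆ := by
  have h := sum_lie_killingDual e hS
    (LinearMap.mk₂ K (fun y z : L => ⁅y, c z⁆) (by simp) (by simp) (by simp) (by simp)) x
  simp only [LinearMap.mk₂_apply] at h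
  have : ∀ i, ⁅x, ⁅S (e i), c (killingDual e i)⁆⁆ = ⁅⁅x, S (e i)⁆, c (killingDual e i)⁆ +
      ⁅S (e i), c ⁅x, killingDual e i⁆⁆ + ⁅S (e i), ⁅killingDual e i, c x⁆⁆ := fun i => by
    rw [leibniz_lie x, hc, lie_sub]
    abel
  rw [lie_sum, casimir_apply]
  simp only [this, Finset.sum_add_distrib, h]
  abel

/-- The same homotopy one degree higher, with primitive $y\mapsto\sum_i Se_i\cdot\omega(e'_i,y)$. -/
theorem casimir_comp_twoCocycle {S : Module.End K L} (hS : S ∈ centroid K L)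
    {ω : L →ₗ[K] L →ₗ[K] M} (hω : IsTwoCocycle ω) (x y : L) :
    casimir M e S (ω x y) =
      coboundary (∑ i, toEnd K L M (S (e i)) ∘ₗ ω (killingDual e i)) x y := by
  have h : ∀ x y : L, ∑ i, ⁅⁅x, S (e i)⁆, ω (killingDual e i) y⁆ =
      -∑ i, ⁅S (e i), ω ⁅x, killingDual e i⁆ y⁆ := fun x y => by
    simpa using sum_lie_killingDual e hS
      (LinearMap.mk₂ K (fun u v : L => ⁅u, ω v y⁆) (by simp) (by simp) (by simp) (by simp)) x
  have h1 : ∀ x y : L, ∑ i, ⁅x, ⁅S (e i), ω (killingDual e i) y⁆⁆ =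
      ∑ i, ⁅S (e i), ⁅x, ω (killingDual e i) y⁆ - ω ⁅x, killingDual e i⁆ y⁆ := fun x y => by
    simp only [leibniz_lie x, Finset.sum_add_distrib, h, lie_sub, Finset.sum_sub_distrib]
    abel
  rw [casimir_apply]
  simp only [coboundary_apply, LinearMap.sum_apply, LinearMap.comp_apply, toEnd_apply_apply,
    lie_sum, h1, ← Finset.sum_sub_distrib, ← lie_sub]
  refine Finset.sum_congr rfl fun i _ => congrArg _ ?_
  have := hω.closed x y (killingDual e i)
  have e1 : ω y ⁅killingDual e i, x⁆ = ω ⁅x, killingDual e i⁆ y := by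
    rw [← lie_skew, map_neg, hω.skew, neg_neg]
  rw [← sub_eq_zero, ← this, e1, hω.skew x ⁅_, _⁆, hω.skew y (killingDual e i), lie_neg]
  abel

end Casimir

section Vanishing

/-- Devissage for finite-dimensional modules over a semisimple Lie algebra: a nontrivial
module has a nonzero proper submodule, or is trivial, or has an invertible Casimir operator. -/
theorem exists_submodule_or_casimir_bijective (K L M : Type*) [Field K] [LieRing L]
    [LieAlgebra K L] [AddCommGroup M] [Module K M] [LieRingModule L M] [LieModule K L M]
    [CharZero K] [FiniteDimensional K L] [IsKilling K L] [FiniteDimensional K M] [Nontrivial M] :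
    (∃ N : LieSubmodule K L M, N ≠ ⊥ ∧ N ≠ ⊤) ∨ (∀ (x : L) (m : M), ⁅x, m⁆ = 0) ∨
      ∃ S ∈ centroid K L, Function.Bijective (casimir M (Module.finBasis K L) S) := by
  by_cases h : traceForm K L M = 0
  · by_cases ht : maxTrivSubmodule K L M = ⊤
    · refine Or.inr (Or.inl fun x m => ?_)
      have : m ∈ maxTrivSubmodule K L M := by rw [ht]; trivial
      exact this x
    · exact Or.inl ⟨_, maxTrivSubmodule_ne_bot_of_traceForm_eq_zero h, ht⟩
  · obtain ⟨S, hS, h0⟩ := exists_casimir_ne_zero K L M h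
    -- The Casimir operator is equivariant, so its kernel is a submodule, and it is proper because
    -- the operator is nonzero.
    let C : M →ₗ⁅K,L⁆ M :=
      { casimir M (Module.finBasis K L) S with
        map_lie' := fun {x m} => casimir_lie (Module.finBasis K L) hS x m }
    by_cases hb : C.ker = ⊥
    · refine Or.inr (Or.inr ⟨S, hS, ?_⟩)
      have hi : Function.Injective (casimir M (Module.finBasis K L) S) := by
        rw [← LinearMap.ker_eq_bot, Submodule.eq_bot_iff]
        intro m hm
        have : m ∈ C.ker := hm
        simpa [hb] using this
      exact ⟨hi, LinearMap.injective_iff_surjective.1 hi⟩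
    · refine Or.inl ⟨C.ker, hb, fun ht => h0 ?_⟩
      ext m
      have : m ∈ C.ker := by rw [ht]; trivial
      exact this

/-- **Whitehead's first lemma**. -/
theorem vanishingOne {K L : Type*} [Field K] [LieRing L] [LieAlgebra K L]
    [CharZero K] [FiniteDimensional K L] [IsKilling K L] (M : Type*) [AddCommGroup M] [Module K M]
    [LieRingModule L M] [LieModule K L M] [FiniteDimensional K M] : VanishingOne K L M := by
  induction hd : Module.finrank K M using Nat.strong_induction_on generalizing M with
  | _ d ih =>
  subst hd
  cases subsingleton_or_nontrivial M with
  | inl _ => exact fun c _ => ⟨0, fun x => Subsingleton.elim _ _⟩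
  | inr _ =>
  rcases exists_submodule_or_casimir_bijective K L M with ⟨N, h1, h2⟩ | ht | ⟨S, hS, hb⟩
  · have : FiniteDimensional K (M ⧸ N) := inferInstanceAs (FiniteDimensional K (M ⧸ N.toSubmodule))
    refine VanishingOne.of_exact (LieSubmodule.Quotient.mk' N)
      (LieSubmodule.Quotient.surjective_mk' N) (fun _ => LieSubmodule.Quotient.mk_eq_zero N)
      (ih _ ?_ _ rfl) (ih _ ?_ _ rfl)
    · exact Submodule.finrank_lt (by simpa using h2)
    · exact LieSubmodule.finrank_quotient_lt h1
  · intro c hc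
    refine ⟨0, fun x => ?_⟩
    rw [lie_zero]
    -- On a trivial module a 1-cocycle kills all brackets, and these span `L`.
    refine induction_lie_mem (K := K) (p := fun x => c x = 0) (map_zero c)
      (fun x y hx hy => by simp [hx, hy]) (fun a x hx => by simp [hx])
      (fun x y => by simp [hc x y, ht]) x
  · intro c hc
    let C := LinearEquiv.ofBijective _ hb
    refine ⟨C.symm (∑ i, ⁅S (Module.finBasis K L i), c (killingDual (Module.finBasis K L) i)⁆),
      fun x => ?_⟩
    rw [← linearEquiv_symm_lie C (casimir_lie _ hS), LinearEquiv.eq_symm_apply]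
    exact casimir_apply_oneCocycle _ hS hc x

/-- **Whitehead's second lemma**. -/
theorem vanishingTwo {K L : Type*} [Field K] [LieRing L] [LieAlgebra K L]
    [CharZero K] [FiniteDimensional K L] [IsKilling K L] (M : Type*) [AddCommGroup M] [Module K M]
    [LieRingModule L M] [LieModule K L M] [FiniteDimensional K M] : VanishingTwo K L M := by
  induction hd : Module.finrank K M using Nat.strong_induction_on generalizing M with
  | _ d ih =>
  subst hd
  cases subsingleton_or_nontrivial M with
  | inl _ => exact fun c _ => ⟨0, LinearMap.ext₂ fun x y => Subsingleton.elim _ _⟩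
  | inr _ =>
  rcases exists_submodule_or_casimir_bijective K L M with ⟨N, h1, h2⟩ | ht | ⟨S, hS, hb⟩
  · have : FiniteDimensional K (M ⧸ N) := inferInstanceAs (FiniteDimensional K (M ⧸ N.toSubmodule))
    refine VanishingTwo.of_exact (LieSubmodule.Quotient.mk' N)
      (LieSubmodule.Quotient.surjective_mk' N) (fun _ => LieSubmodule.Quotient.mk_eq_zero N)
      (ih _ ?_ _ rfl) (ih _ ?_ _ rfl)
    · exact Submodule.finrank_lt (by simpa using h2)
    · exact LieSubmodule.finrank_quotient_lt h1
  -- The first lemma is applied to the module `L →ₗ[K] M`.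
  · exact VanishingTwo.of_isTrivial ht (vanishingOne _)
  · intro ω hω
    let C := LinearEquiv.ofBijective _ hb
    let e := Module.finBasis K L
    refine ⟨C.symm.toLinearMap ∘ₗ ∑ i, toEnd K L M (S (e i)) ∘ₗ ω (killingDual e i), ?_⟩
    ext x y
    simp only [coboundary_apply, LinearMap.comp_apply, LinearEquiv.coe_coe]
    rw [← linearEquiv_symm_lie C (casimir_lie _ hS), ← linearEquiv_symm_lie C (casimir_lie _ hS),
      ← map_sub, ← map_sub, LinearEquiv.eq_symm_apply]
    exact casimir_comp_twoCocycle e hS hω x y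

end Vanishing

end LieModule

/-! ### Calculus of bivectors and trivectors. -/

namespace CLPoisson

section Calculus

variable {K R : Type*} [Field K] [CommRing R] [Algebra K R]

namespace Bivector

variable (P : Bivector K R) (f g h : R)

theorem apply_self : P.1 f f = 0 := P.2.1 f

theorem add_left : P.1 (f + g) h = P.1 f h + P.1 g h := map_add (ham P h) f g

theorem sub_left : P.1 (f - g) h = P.1 f h - P.1 g h := map_sub (ham P h) f g

theorem neg_left : P.1 (-f) h = -P.1 f h := map_neg (ham P h) f

theorem zero_left : P.1 0 h = 0 := map_zero (ham P h)

theorem smul_left (c : K) : P.1 (c • f) h = c • P.1 f h := (ham P h).map_smul c f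

theorem mul_left : P.1 (f * g) h = f * P.1 g h + g * P.1 f h := (ham P h).leibniz f g

theorem add_right : P.1 f (g + h) = P.1 f g + P.1 f h := by
  rw [P.skew, add_left, P.skew g, P.skew h]; ring

theorem sub_right : P.1 f (g - h) = P.1 f g - P.1 f h := by
  rw [P.skew, sub_left, P.skew g, P.skew h]; ring

theorem neg_right : P.1 f (-g) = -P.1 f g := by
  rw [P.skew, neg_left, P.skew f g]

theorem zero_right : P.1 f 0 = 0 := by
  rw [P.skew, zero_left, neg_zero]

theorem smul_right (c : K) : P.1 f (c • g) = c • P.1 f g := by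
  rw [P.skew, smul_left, P.skew g, smul_neg, neg_neg]

theorem mul_right : P.1 f (g * h) = g * P.1 f h + h * P.1 f g := by
  rw [P.skew, mul_left, P.skew g, P.skew h]; ring

end Bivector

namespace Trivector

variable (T : Trivector K R) (f g h : R)

theorem add_left (f' : R) : T.1 (f + f') g h = T.1 f g h + T.1 f' g h := by
  obtain ⟨D, hD⟩ := T.2.2.2.2.2 g h
  simp only [← hD, map_add]

theorem add_middle (g' : R) : T.1 f (g + g') h = T.1 f g h + T.1 f g' h := by
  obtain ⟨D, hD⟩ := T.2.2.2.2.1 f h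
  simp only [← hD, map_add]

theorem add_right (h' : R) : T.1 f g (h + h') = T.1 f g h + T.1 f g h' := by
  obtain ⟨D, hD⟩ := T.2.2.2.1 f g
  simp only [← hD, map_add]

theorem swap_left : T.1 f g h = -T.1 g f h := by
  have := T.2.1 (f + g) h
  rw [add_left, add_middle, add_middle, T.2.1, T.2.1] at this
  linear_combination this

theorem swap_right : T.1 f g h = -T.1 f h g := by
  have := T.2.2.1 f (g + h)
  rw [add_middle, add_right, add_right, T.2.2.1, T.2.2.1] at this
  linear_combination this

end Trivector

theorem lieDeriv_apply (Z : VectorField K R) (P : Bivector K R) (f g : R) :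
    (lieDeriv Z P).1 f g = Z (P.1 f g) - P.1 (Z f) g - P.1 f (Z g) := rfl

theorem schouten_apply (P Q : Bivector K R) (f g h : R) :
    (schouten P Q).1 f g h = (P.1 f (Q.1 g h) + P.1 g (Q.1 h f) + P.1 h (Q.1 f g)) +
      (Q.1 f (P.1 g h) + Q.1 g (P.1 h f) + Q.1 h (P.1 f g)) := rfl

theorem wedgeBi_apply (Z : VectorField K R) (P : Bivector K R) (f g h : R) :
    (wedgeBi Z P).1 f g h = Z f * P.1 g h + Z g * P.1 h f + Z h * P.1 f g := rfl

theorem wedge_apply (Y Z : VectorField K R) (f g : R) :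
    (wedge Y Z).1 f g = Y f * Z g - Y g * Z f := rfl

theorem ham_apply (P : Bivector K R) (q f : R) : ham P q f = P.1 f q := rfl

theorem schoutenVF_eq_zero_iff (P : Bivector K R) (Z : VectorField K R) :
    schoutenVF P Z = 0 ↔ lieDeriv Z P = 0 := neg_eq_zero

variable [CharZero K]

theorem eq_zero_of_two_mul (K : Type*) {R : Type*} [Field K] [CharZero K] [CommRing R]
    [Algebra K R] {r : R} (h : 2 * r = 0) : r = 0 := by
  have h2 : (2 : K) • r = 0 := by rw [← h, Algebra.smul_def, map_ofNat]
  exact (smul_eq_zero.1 h2).resolve_left two_ne_zero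

theorem IsPoisson.jacobi {P : Bivector K R} (hP : IsPoisson P) (f g h : R) :
    P.1 f (P.1 g h) + P.1 g (P.1 h f) + P.1 h (P.1 f g) = 0 := by
  have h1 : (schouten P P).1 f g h = 0 := by rw [hP]; rfl
  rw [schouten_apply] at h1
  exact eq_zero_of_two_mul K (by linear_combination h1)

theorem IsPoisson.lieDeriv_ham {P : Bivector K R} (hP : IsPoisson P) (q : R) :
    lieDeriv (ham P q) P = 0 := by
  ext f g
  have := hP.jacobi f g q
  change (lieDeriv (ham P q) P).1 f g = 0
  rw [lieDeriv_apply, ham_apply, ham_apply, ham_apply, P.skew (P.1 f g) q, P.skew (P.1 f q) g,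
    P.skew f q, P.neg_right]
  linear_combination -this

/-- Differentiate the Jacobi identity along `Z` and subtract the Jacobi identities with `Z` applied
to one argument. -/
theorem IsPoisson.schouten_lieDeriv {P : Bivector K R} (hP : IsPoisson P) (Z : VectorField K R) :
    schouten (lieDeriv Z P) P = 0 := by
  ext f g h
  change (schouten (lieDeriv Z P) P).1 f g h = 0
  have h0 := congrArg Z (hP.jacobi f g h)
  have h1 := hP.jacobi (Z f) g h
  have h2 := hP.jacobi f (Z g) h
  have h3 := hP.jacobi f g (Z h)
  simp only [map_add, map_zero] at h0
  simp only [schouten_apply, lieDeriv_apply, P.sub_right]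
  linear_combination h0 - h1 - h2 - h3

end Calculus

/-! ### Reduction to coordinates, and functions independent of $x_0$. -/

section Generators

variable {K σ : Type*} [Field K]

theorem Bivector.ext_X {P Q : Bivector K (MvPolynomial σ K)}
    (h : ∀ i j, P.1 (X i) (X j) = Q.1 (X i) (X j)) : P = Q := by
  have h1 : ∀ f j, P.1 f (X j) = Q.1 f (X j) := fun f j =>
    congrArg (fun D : Derivation K _ _ => D f)
      (derivation_ext (D₁ := ham P (X j)) (D₂ := ham Q (X j)) fun i => h i j)
  ext1
  funext f g
  rw [P.skew, Q.skew]
  refine congrArg _ (congrArg (fun D : Derivation K _ _ => D g)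
    (derivation_ext (D₁ := ham P f) (D₂ := ham Q f) fun i => ?_))
  change P.1 _ _ = Q.1 _ _
  rw [P.skew, Q.skew, h1]

theorem Trivector.ext_X {T U : Trivector K (MvPolynomial σ K)}
    (h : ∀ i j k, T.1 (X i) (X j) (X k) = U.1 (X i) (X j) (X k)) : T = U := by
  have h1 : ∀ f j k, T.1 f (X j) (X k) = U.1 f (X j) (X k) := fun f j k => by
    obtain ⟨D, hD⟩ := T.2.2.2.2.2 (X j) (X k)
    obtain ⟨D', hD'⟩ := U.2.2.2.2.2 (X j) (X k)
    rw [← hD, ← hD', derivation_ext (D₁ := D) (D₂ := D') fun i => by rw [hD, hD', h]]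
  have h2 : ∀ f g k, T.1 f g (X k) = U.1 f g (X k) := fun f g k => by
    obtain ⟨D, hD⟩ := T.2.2.2.2.1 f (X k)
    obtain ⟨D', hD'⟩ := U.2.2.2.2.1 f (X k)
    rw [← hD, ← hD', derivation_ext (D₁ := D) (D₂ := D') fun i => by rw [hD, hD', h1]]
  ext1
  funext f g k
  obtain ⟨D, hD⟩ := T.2.2.2.1 f g
  obtain ⟨D', hD'⟩ := U.2.2.2.1 f g
  rw [← hD, ← hD', derivation_ext (D₁ := D) (D₂ := D') fun i => by rw [hD, hD', h2]]

variable {ι : Type*}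

theorem X_some (i : ι) : (X (some i) : MvPolynomial (Option ι) K) = extFun (X i) :=
  (rename_X _ _).symm

theorem Bivector.ext_option {P Q : Bivector K (MvPolynomial (Option ι) K)}
    (h : ∀ f g, P.1 (extFun f) (extFun g) = Q.1 (extFun f) (extFun g))
    (h0 : ∀ f, P.1 (extFun f) (X none) = Q.1 (extFun f) (X none)) : P = Q := by
  refine Bivector.ext_X fun i j => ?_
  cases i <;> cases j <;> simp only [X_some, P.apply_self, Q.apply_self, h, h0]
  rw [P.skew, Q.skew, h0]

/-- By alternation, components with $x_0$ in two slots vanish and a single $x_0$ can be moved to the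
last slot. -/
theorem Trivector.ext_option {T U : Trivector K (MvPolynomial (Option ι) K)}
    (h : ∀ f g k, T.1 (extFun f) (extFun g) (extFun k) = U.1 (extFun f) (extFun g) (extFun k))
    (h0 : ∀ f g, T.1 (extFun f) (extFun g) (X none) = U.1 (extFun f) (extFun g) (X none)) :
    T = U := by
  refine Trivector.ext_X fun i j k => ?_
  have h00 : ∀ f, T.1 f (X none) (X none) = U.1 f (X none) (X none) := fun f => by
    rw [T.2.2.1, U.2.2.1]
  have h1 : ∀ f g, T.1 (extFun f) (X none) g = U.1 (extFun f) (X none) g →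
      T.1 (X none) (extFun f) g = U.1 (X none) (extFun f) g := fun f g hh => by
    rw [T.swap_left, U.swap_left, hh]
  have h2 : ∀ f g, T.1 (extFun f) (X none) (extFun g) = U.1 (extFun f) (X none) (extFun g) :=
    fun f g => by rw [T.swap_right, U.swap_right, h0]
  cases i <;> cases j <;> cases k <;>
    simp only [X_some, h, h0, h2, h00, h1, T.2.1, U.2.1]

section extFun

variable (f g : MvPolynomial ι K)

theorem extFun_add : extFun (f + g) = extFun f + extFun g := map_add (rename some) f g

theorem extFun_sub : extFun (f - g) = extFun f - extFun g := map_sub (rename some) f g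

theorem extFun_mul : extFun (f * g) = extFun f * extFun g := map_mul (rename some) f g

theorem extFun_neg : extFun (-f) = -extFun f := map_neg (rename some) f

theorem extFun_zero : extFun (0 : MvPolynomial ι K) = 0 := map_zero (rename some)

theorem extFun_injective : Function.Injective (extFun : MvPolynomial ι K → _) :=
  rename_injective _ (Option.some_injective ι)

theorem pderiv_none_extFun : pderiv none (extFun f) = 0 := by
  refine pderiv_eq_zero_of_notMem_vars fun h => ?_
  classical
  simpa using vars_rename some f h

theorem pderiv_some_extFun (i : ι) : pderiv (some i) (extFun f) = extFun (pderiv i f) :=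
  pderiv_rename (Option.some_injective ι) i f

/-- Applying $\partial/\partial x_0$ isolates `g`. This is how identities on $\mathfrak g^*$ are
split by powers of $x_0$. -/
theorem extFun_add_X_mul_eq_zero_iff :
    extFun f + X none * extFun g = 0 ↔ f = 0 ∧ g = 0 := by
  refine ⟨fun h => ?_, fun ⟨hf, hg⟩ => by rw [hf, hg, extFun_zero, mul_zero, add_zero]⟩
  have h1 := congrArg (pderiv none) h
  rw [map_add, pderiv_mul, pderiv_none_extFun, pderiv_none_extFun, pderiv_X_self, map_zero] at h1
  have hg : g = 0 := extFun_injective (by rw [extFun_zero, ← h1]; ring)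
  refine ⟨extFun_injective ?_, hg⟩
  rwa [hg, extFun_zero, mul_zero, add_zero] at h

/-- The restriction of functions to the hyperplane `x₀ = 0`. -/
noncomputable def restrictFun : MvPolynomial (Option ι) K →ₐ[K] MvPolynomial ι K :=
  aeval fun o => o.elim 0 X

theorem restrictFun_extFun : restrictFun (extFun f) = f := by
  rw [extFun, restrictFun, aeval_rename]
  exact aeval_X_left_apply f

theorem extFun_restrictFun [CharZero K] {p : MvPolynomial (Option ι) K}
    (hp : pderiv none p = 0) : extFun (restrictFun p) = p := by
  suffices h : (p.vars : Set (Option ι)) ⊆ Set.range some by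
    obtain ⟨r, rfl⟩ := exists_rename_eq_of_vars_subset_range p some (Option.some_injective ι) h
    exact congrArg extFun (restrictFun_extFun r)
  intro o ho
  cases o with
  | some i => exact ⟨i, rfl⟩
  | none =>
    obtain ⟨m, hm, hmo⟩ := (mem_vars_iff_mem_support none).1 ho
    exfalso
    rw [mem_support_iff] at hm
    rw [Finsupp.mem_support_iff] at hmo
    -- A monomial containing $x_0$ would survive in $\partial p/\partial x_0$, its coefficient
    -- multiplied by a positive integer.
    have h1 := coeff_pderiv (i := none) p (m - Finsupp.single none 1)
    have h2 : m - Finsupp.single none 1 + Finsupp.single none 1 = m :=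
      tsub_add_cancel_of_le (by simpa using Nat.one_le_iff_ne_zero.2 hmo)
    rw [hp, coeff_zero, h2] at h1
    rcases mul_eq_zero.1 h1.symm with h3 | h3
    · exact hm h3
    · exact Nat.cast_add_one_ne_zero _ h3

end extFun

/-- The restriction of a vector field to the hyperplane `x₀ = 0`, with its `∂/∂x₀`-component
dropped. -/
noncomputable def restrictField (Z : VectorField K (MvPolynomial (Option ι) K)) :
    VectorField K (MvPolynomial ι K) where
  toFun f := restrictFun (Z (extFun f))
  map_add' f g := by rw [extFun_add, map_add, map_add]
  map_smul' c f := by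
    rw [extFun, map_smul, Z.map_smul, map_smul]
    rfl
  map_one_eq_zero' := by
    change restrictFun (Z (rename some 1)) = 0
    rw [map_one, Z.map_one_eq_zero, map_zero]
  leibniz' f g := by
    change restrictFun (Z (extFun (f * g))) = f * restrictFun (Z (extFun g)) +
      g * restrictFun (Z (extFun f))
    simp only [extFun_mul, Z.leibniz, map_add, smul_eq_mul, map_mul, restrictFun_extFun]

/-- The restriction of a bivector to the hyperplane `x₀ = 0`, with its components along `∂/∂x₀`
dropped. -/
noncomputable def restrictBivector (P : Bivector K (MvPolynomial (Option ι) K)) :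
    Bivector K (MvPolynomial ι K) :=
  ⟨fun f g => restrictFun (P.1 (extFun f) (extFun g)),
    fun f => by simp only [P.apply_self, map_zero],
    fun f => ⟨-restrictField (ham P (extFun f)), fun g => by
      change -restrictFun _ = restrictFun (P.1 (extFun f) (extFun g))
      rw [P.skew (extFun f), map_neg]; rfl⟩,
    fun g => ⟨restrictField (ham P (extFun g)), fun f => rfl⟩⟩

end Generators

end CLPoisson

/-! ### The Lie–Poisson bivector, and its extension from $\mathfrak s^*$ to $\mathfrak g^*$. -/

namespace CLPoisson

section LiePoisson

variable {K L σ : Type*} [Field K] [LieRing L] [LieAlgebra K L] [Fintype σ]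
  (B : Module.Basis σ K L)

theorem linFun_add (y z : L) : linFun B (y + z) = linFun B y + linFun B z := by
  simp [linFun, add_mul, Finset.sum_add_distrib]

theorem linFun_smul (c : K) (y : L) : linFun B (c • y) = c • linFun B y := by
  simp [linFun, Finset.smul_sum, smul_eq_C_mul, mul_assoc]

theorem linFun_zero : linFun B 0 = 0 := by simp [linFun]

theorem linFun_basis (i : σ) : linFun B (B i) = X i := by
  classical
  simp [linFun, Finsupp.single_apply]

theorem linFun_isHomogeneous (y : L) : (linFun B y).IsHomogeneous 1 :=
  IsHomogeneous.sum _ _ _ fun i _ => by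
    simpa using (isHomogeneous_C σ (B.repr y i)).mul (isHomogeneous_X K i)

theorem liePoisson_apply (f g : MvPolynomial σ K) :
    (liePoisson B).1 f g = ∑ i, ∑ j, pderiv i f * pderiv j g * linFun B ⁅B i, B j⁆ := rfl

theorem liePoisson_X (i j : σ) : (liePoisson B).1 (X i) (X j) = linFun B ⁅B i, B j⁆ := by
  classical
  simp [liePoisson_apply, pderiv_X, Pi.single_apply]

theorem liePoisson_isHomogeneous {f g : MvPolynomial σ K} {m n : ℕ} (hf : f.IsHomogeneous (m + 1))
    (hg : g.IsHomogeneous (n + 1)) : ((liePoisson B).1 f g).IsHomogeneous (m + n + 1) :=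
  IsHomogeneous.sum _ _ _ fun _ _ => IsHomogeneous.sum _ _ _ fun _ _ =>
    (hf.pderiv.mul hg.pderiv).mul (linFun_isHomogeneous B _)

/-- The linear functions, as a linear map. -/
noncomputable def linFunₗ : L →ₗ[K] MvPolynomial σ K where
  toFun := linFun B
  map_add' := linFun_add B
  map_smul' := linFun_smul B

/-- A bivector, as a bilinear map. -/
noncomputable def Bivector.toBilin (P : Bivector K (MvPolynomial σ K)) :
    MvPolynomial σ K →ₗ[K] MvPolynomial σ K →ₗ[K] MvPolynomial σ K :=
  LinearMap.mk₂ K P.1 P.add_left (fun c f g => P.smul_left f g c) P.add_right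
    fun c f g => P.smul_right f g c

theorem liePoisson_linFun (y z : L) :
    (liePoisson B).1 (linFun B y) (linFun B z) = linFun B ⁅y, z⁆ := by
  have h := B.ext (f₁ := (liePoisson B).toBilin.compl₁₂ (linFunₗ B) (linFunₗ B))
    (f₂ := (LieModule.toEnd K L L).toLinearMap.compr₂ (linFunₗ B)) fun i => B.ext fun j => by
      change (liePoisson B).1 (linFun B (B i)) (linFun B (B j)) = linFun B ⁅B i, B j⁆
      rw [linFun_basis, linFun_basis, liePoisson_X]
  exact LinearMap.congr_fun₂ h y z

theorem liePoisson_isPoisson : IsPoisson (liePoisson B) := by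
  refine Trivector.ext_X fun i j k => ?_
  rw [schouten_apply]
  simp only [← linFun_basis B, liePoisson_linFun, ← linFun_add, lie_jacobi, add_zero,
    linFun_zero]
  rfl

end LiePoisson

section LiePoissonField

variable {K s ι : Type*} [Field K] [LieRing s] [LieAlgebra K s] [Fintype ι]
  (b : Module.Basis ι K s)

theorem derivation_linFun (D : VectorField K (MvPolynomial ι K)) {n : ℕ}
    (hD : ∀ i, (D (X i)).IsHomogeneous n) (y : s) : (D (linFun b y)).IsHomogeneous n := by
  rw [linFun, map_sum]
  refine IsHomogeneous.sum _ _ _ fun i _ => ?_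
  rw [← smul_eq_C_mul, D.map_smul, smul_eq_C_mul]
  simpa using (isHomogeneous_C ι _).mul (hD i)

theorem bivector_linFun (P : Bivector K (MvPolynomial ι K)) {n : ℕ}
    (hP : ∀ i j, (P.1 (X i) (X j)).IsHomogeneous n) (y z : s) :
    (P.1 (linFun b y) (linFun b z)).IsHomogeneous n := by
  refine derivation_linFun b (ham P (linFun b z)) (fun i => ?_) y
  rw [ham_apply, P.skew]
  refine (derivation_linFun b (ham P (X i)) (fun j => hP j i) z).neg

/-- On two linear functions the three terms are $1-1-1$ times the bracket. -/
theorem lieDeriv_euler_liePoisson : lieDeriv euler (liePoisson b) = -liePoisson b := by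
  refine Bivector.ext_X fun i j => ?_
  have hE : ∀ y : s, euler (linFun b y) = linFun b y := fun y => by
    simp only [linFun, map_sum]
    simp [euler, mkDerivation_X]
  change _ = -(liePoisson b).1 (X i) (X j)
  rw [lieDeriv_apply, liePoisson_X, hE, euler, mkDerivation_X, mkDerivation_X, liePoisson_X]
  ring

variable (a : Module.Dual K (s × K)) (ha : a ≠ 0) (has : ∀ y : s, a (y, 0) = 0)

theorem linFun_adaptedBasis (y : s) :
    linFun (adaptedBasis b a ha has) (y, 0) = extFun (linFun b y) := by
  have h : (linFunₗ (adaptedBasis b a ha has)) ∘ₗ LinearMap.inl K s K =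
      (rename some).toLinearMap ∘ₗ linFunₗ b := b.ext fun i => by
    change linFun _ (b i, 0) = extFun (linFun b (b i))
    rw [← adaptedBasis_some b a ha has i, linFun_basis, linFun_basis, X_some]
  exact LinearMap.congr_fun h y

theorem liePoisson_none (f : MvPolynomial (Option ι) K) :
    (liePoisson (L := s × K) (adaptedBasis b a ha has)).1 f (X none) = 0 := by
  classical
  rw [liePoisson_apply]
  refine Finset.sum_eq_zero fun i _ => Finset.sum_eq_zero fun j _ => ?_
  cases j with
  | some j => rw [pderiv_X_of_ne (by simp), mul_zero, zero_mul]
  | none =>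
    have : ⁅adaptedBasis b a ha has i, adaptedBasis b a ha has none⁆ = (0 : s × K) := by
      rw [adaptedBasis_none]
      ext
      · simp
      · exact sub_eq_zero.2 (mul_comm _ _)
    rw [this, linFun_zero, mul_zero]

theorem liePoisson_extFun (f g : MvPolynomial ι K) :
    (liePoisson (L := s × K) (adaptedBasis b a ha has)).1 (extFun f) (extFun g) =
      extFun ((liePoisson b).1 f g) := by
  have hb : ∀ i j, linFun (adaptedBasis b a ha has)
      ⁅adaptedBasis b a ha has (some i), adaptedBasis b a ha has (some j)⁆ =
        extFun (linFun b ⁅b i, b j⁆) := fun i j => by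
    rw [adaptedBasis_some, adaptedBasis_some, ← linFun_adaptedBasis b a ha has]
    congr 1
    ext <;> simp
  rw [liePoisson_apply, liePoisson_apply, Fintype.sum_option]
  simp only [Fintype.sum_option, pderiv_none_extFun, pderiv_some_extFun, hb, zero_mul, mul_zero,
    Finset.sum_const_zero, zero_add, ← extFun_mul]
  simp only [extFun, map_sum]

end LiePoissonField

section Extends

variable {K ι : Type*} [Field K]

/-- The bivector `P'` on `g*` is the bivector `P` on `s*`, treated as independent of `x₀`. -/
structure Bivector.Extends (P' : Bivector K (MvPolynomial (Option ι) K))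
    (P : Bivector K (MvPolynomial ι K)) : Prop where
  extFun : ∀ f g, P'.1 (extFun f) (CLPoisson.extFun g) = CLPoisson.extFun (P.1 f g)
  none : ∀ f, P'.1 (CLPoisson.extFun f) (X none) = 0

theorem extField_extFun (Y : VectorField K (MvPolynomial ι K)) (f : MvPolynomial ι K) :
    extField Y (extFun f) = extFun (Y f) := by
  induction f using MvPolynomial.induction_on with
  | C r =>
    have : extFun (ι := ι) (C r) = C r := rename_C _ _
    rw [this, derivation_C, derivation_C, extFun_zero]
  | add f g hf hg => rw [extFun_add, map_add, map_add, extFun_add, hf, hg]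
  | mul_X f i hf =>
    rw [extFun_mul, Derivation.leibniz, Derivation.leibniz, hf, ← X_some]
    simp only [smul_eq_mul, extFun_add, extFun_mul, ← X_some]
    rw [extField, mkDerivation_X]
    rfl

theorem extField_none (Y : VectorField K (MvPolynomial ι K)) : extField Y (X none) = 0 :=
  mkDerivation_X _ _ _

variable {P' : Bivector K (MvPolynomial (Option ι) K)} {P : Bivector K (MvPolynomial ι K)}

theorem Bivector.Extends.lieDeriv (h : P'.Extends P)
    {Z' : VectorField K (MvPolynomial (Option ι) K)} {Z : VectorField K (MvPolynomial ι K)}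
    (hZ : ∀ f, Z' (CLPoisson.extFun f) = CLPoisson.extFun (Z f)) (hZ0 : Z' (X Option.none) = 0) :
    (lieDeriv Z' P').Extends (lieDeriv Z P) where
  extFun f g := by
    simp only [lieDeriv_apply, hZ, h.extFun, extFun_sub]
  none f := by
    rw [lieDeriv_apply, hZ, hZ0, h.none, h.none, P'.zero_right, map_zero, sub_zero, sub_zero]

theorem Bivector.Extends.eq_zero_iff (h : P'.Extends P) : P' = 0 ↔ P = 0 := by
  constructor
  · intro h0
    ext1
    funext f g
    apply extFun_injective
    rw [← h.extFun, h0]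
    exact extFun_zero.symm
  · rintro rfl
    refine Bivector.ext_option (fun f g => ?_) fun f => h.none f
    rw [h.extFun]
    exact extFun_zero

/-- On functions from $\mathfrak s^*$ both sides are pullbacks, and pullback is injective;
components with an $x_0$ slot vanish on both sides. -/
theorem Bivector.Extends.basicIdentities_iff (h : P'.Extends P)
    (Y : VectorField K (MvPolynomial ι K)) (q : MvPolynomial ι K) :
    BasicIdentities P' (extField Y) (CLPoisson.extFun q) ↔ BasicIdentities P Y q := by
  have hπ := h.lieDeriv (extField_extFun Y) (extField_none Y)
  have hV : ∀ f, ham P' (CLPoisson.extFun q) (CLPoisson.extFun f) =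
      CLPoisson.extFun (ham P q f) := fun f => h.extFun f q
  have hV0 : ham P' (CLPoisson.extFun q) (X Option.none) = 0 := by
    rw [ham_apply, P'.skew, h.none, neg_zero]
  refine and_congr ?_ ?_
  · have h1 : ∀ f g k, (schouten (CLPoisson.lieDeriv (extField Y) P')
        (CLPoisson.lieDeriv (extField Y) P')).1
          (CLPoisson.extFun f) (CLPoisson.extFun g) (CLPoisson.extFun k) =
        CLPoisson.extFun ((schouten (CLPoisson.lieDeriv Y P) (CLPoisson.lieDeriv Y P)).1 f g k) :=
      fun f g k => by simp only [schouten_apply, hπ.extFun, extFun_add]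
    have h2 : ∀ f g k, ((2 : MvPolynomial (Option ι) K) •
        wedgeBi (ham P' (CLPoisson.extFun q)) P').1
          (CLPoisson.extFun f) (CLPoisson.extFun g) (CLPoisson.extFun k) =
        CLPoisson.extFun (((2 : MvPolynomial ι K) • wedgeBi (ham P q) P).1 f g k) :=
      fun f g k => by
        change 2 * (wedgeBi (ham P' (CLPoisson.extFun q)) P').1 _ _ _ =
          CLPoisson.extFun (2 * (wedgeBi (ham P q) P).1 f g k)
        simp only [two_mul, wedgeBi_apply, hV, h.extFun, extFun_add, extFun_mul]
    constructor
    · intro h0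
      ext1
      funext f g k
      apply extFun_injective
      rw [← h1, ← h2, h0]
    · intro h0
      refine Trivector.ext_option (fun f g k => by rw [h1, h2, h0]) fun f g => ?_
      change _ = 2 * (wedgeBi (ham P' (CLPoisson.extFun q)) P').1 _ _ _
      rw [wedgeBi_apply, schouten_apply, hV0, P'.skew (X Option.none), h.none, h.none,
        (CLPoisson.lieDeriv (extField Y) P').skew (X Option.none), hπ.none, hπ.none, hπ.extFun,
        Bivector.skew _ (X Option.none), hπ.none]
      simp only [neg_zero, Bivector.zero_right]
      ring
  · rw [schoutenVF_eq_zero_iff, schoutenVF_eq_zero_iff]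
    exact (hπ.lieDeriv hV hV0).eq_zero_iff

end Extends

/-! ### Splitting the Poisson condition by powers of $x_0$. -/

section Decomposition

variable {K ι : Type*} [Field K]

/-- The Schouten square of `π - V ∧ ∂/∂x₀ + x₀ π₁`, for bivectors `π`, `π₁` and a vector field
`V` which do not depend on `x₀`. -/
theorem isPoisson_iff_of_decomposition [CharZero K] {P : Bivector K (MvPolynomial (Option ι) K)}
    {π π₁ : Bivector K (MvPolynomial ι K)} {V : VectorField K (MvPolynomial ι K)}
    (h : ∀ f g, P.1 (extFun f) (extFun g) = extFun (π.1 f g) + X none * extFun (π₁.1 f g))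
    (h0 : ∀ f, P.1 (extFun f) (X none) = -extFun (V f)) (h₁ : IsPoisson π₁) :
    IsPoisson P ↔ (schouten π π = (2 : MvPolynomial ι K) • wedgeBi V π₁ ∧ schouten π π₁ = 0) ∧
      lieDeriv V π = 0 ∧ lieDeriv V π₁ = 0 := by
  have h0' : ∀ f, P.1 (X none) (extFun f) = extFun (V f) := fun f => by
    rw [P.skew, h0, neg_neg]
  -- The $V\wedge\pi_1$ term comes from `P` differentiating the coefficient $x_0$; the $x_0^2$ term
  -- is the Jacobiator of $\pi_1$.
  have e1 : ∀ f g k, (schouten P P).1 (extFun f) (extFun g) (extFun k) =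
      extFun ((schouten π π).1 f g k - 2 * (wedgeBi V π₁).1 f g k) +
        X none * extFun (2 * (schouten π π₁).1 f g k) := fun f g k => by
    have hj := congrArg extFun (h₁.jacobi f g k)
    simp only [extFun_add, extFun_zero] at hj
    simp only [schouten_apply, wedgeBi_apply, h, h0, P.add_right, P.mul_right, extFun_add,
      extFun_sub, extFun_mul, two_mul]
    linear_combination (2 * X none ^ 2) * hj
  have e2 : ∀ f g, (schouten P P).1 (extFun f) (extFun g) (X none) =
      extFun (2 * (lieDeriv V π).1 f g) + X none * extFun (2 * (lieDeriv V π₁).1 f g) :=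
    fun f g => by
      simp only [schouten_apply, lieDeriv_apply, h, h0, h0', P.add_right, P.mul_right,
        P.neg_right, P.apply_self, extFun_add, extFun_sub, two_mul]
      rw [π.skew (V f) g, π₁.skew (V f) g]
      simp only [extFun_neg]
      ring
  constructor
  · intro hP
    have e1' : ∀ f g k, _ := fun f g k => extFun_add_X_mul_eq_zero_iff _ _ |>.1
      ((e1 f g k).symm.trans (by rw [hP]; rfl))
    have e2' : ∀ f g, _ := fun f g => extFun_add_X_mul_eq_zero_iff _ _ |>.1
      ((e2 f g).symm.trans (by rw [hP]; rfl))
    refine ⟨⟨?_, ?_⟩, ?_, ?_⟩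
    · ext1; funext f g k; exact sub_eq_zero.1 (e1' f g k).1
    · ext1; funext f g k; exact eq_zero_of_two_mul K (e1' f g k).2
    · ext1; funext f g; exact eq_zero_of_two_mul K (e2' f g).1
    · ext1; funext f g; exact eq_zero_of_two_mul K (e2' f g).2
  · rintro ⟨⟨a1, a2⟩, a3, a4⟩
    refine Trivector.ext_option (fun f g k => ?_) fun f g => ?_
    · rw [e1]
      refine (extFun_add_X_mul_eq_zero_iff _ _).2 ⟨?_, ?_⟩
      · rw [a1]; exact sub_self _
      · rw [a2]; exact mul_zero _
    · rw [e2]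
      refine (extFun_add_X_mul_eq_zero_iff _ _).2 ⟨?_, ?_⟩
      · rw [a3]; exact mul_zero _
      · rw [a4]; exact mul_zero _

theorem tildeField_extFun (Y : VectorField K (MvPolynomial ι K)) (q f : MvPolynomial ι K) :
    tildeField Y q (extFun f) = extFun (Y f) - X none * extFun (euler f) := by
  simp [tildeField, extField_extFun, pderiv_none_extFun]

theorem tildeField_none (Y : VectorField K (MvPolynomial ι K)) (q : MvPolynomial ι K) :
    tildeField Y q (X none) = extFun q := by
  simp [tildeField, extField_none]

end Decomposition

end CLPoisson

/-! ### Quadratic Poisson cohomology of $\mathfrak s^*$ as Lie algebra cohomology. -/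

namespace CLPoisson

section Cohomology

variable {K s ι : Type*} [Field K] [LieRing s] [LieAlgebra K s] [Fintype ι]
  (b : Module.Basis ι K s)

/-- The action of `s` on homogeneous quadratic polynomials on `s*`, by Hamiltonian vector
fields. -/
@[reducible]
noncomputable def quadraticLieRingModule [CharZero K] :
    LieRingModule s (homogeneousSubmodule ι K 2) where
  bracket y f := ⟨(liePoisson b).1 (linFun b y) f.1,
    liePoisson_isHomogeneous b (m := 0) (n := 1) (linFun_isHomogeneous b y) f.2⟩
  add_lie y z f := by
    ext1
    change (liePoisson b).1 (linFun b (y + z)) f.1 = _ + _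
    rw [linFun_add, Bivector.add_left]
  lie_add y f g := Subtype.ext ((liePoisson b).add_right _ _ _)
  leibniz_lie y z f := by
    ext1
    change (liePoisson b).1 (linFun b y) ((liePoisson b).1 (linFun b z) f.1) =
      (liePoisson b).1 (linFun b ⁅y, z⁆) f.1 +
        (liePoisson b).1 (linFun b z) ((liePoisson b).1 (linFun b y) f.1)
    have h := (liePoisson_isPoisson b).jacobi (linFun b y) (linFun b z) f.1
    rw [liePoisson_linFun, (liePoisson b).skew f.1, (liePoisson b).skew f.1,
      Bivector.neg_right] at h
    linear_combination h

theorem quadraticLieModule [CharZero K] :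
    letI := quadraticLieRingModule b
    LieModule K s (homogeneousSubmodule ι K 2) :=
  letI := quadraticLieRingModule b
  { smul_lie := fun c y f => by
      ext1
      change (liePoisson b).1 (linFun b (c • y)) f.1 = c • _
      rw [linFun_smul, Bivector.smul_left]
      rfl
    lie_smul := fun c y f => Subtype.ext ((liePoisson b).smul_right _ _ c) }

variable [CharZero K] [LieAlgebra.IsKilling K s]

/-- Quadratic Poisson vector fields on `s*` are Hamiltonian. -/
theorem exists_eq_ham_of_lieDeriv_eq_zero {V : VectorField K (MvPolynomial ι K)}
    (hV : V.IsQuadratic) (h : lieDeriv V (liePoisson b) = 0) :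
    ∃ q : MvPolynomial ι K, q.IsHomogeneous 2 ∧ V = ham (liePoisson b) q := by
  let _ := quadraticLieRingModule b
  have := quadraticLieModule b
  have : FiniteDimensional K s := Module.Finite.of_basis b
  have : FiniteDimensional K (homogeneousSubmodule ι K 2) :=
    Module.Finite.iff_fg.2 (homogeneousSubmodule_fg ι K 2)
  -- A vector field is determined by its values on linear functions; $\mathcal L_V\pi_1=0$ there is
  -- exactly the 1-cocycle condition.
  let c : s →ₗ[K] homogeneousSubmodule ι K 2 :=
    (V.toLinearMap ∘ₗ linFunₗ b).codRestrict _ fun y => derivation_linFun b V hV y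
  obtain ⟨m, hm⟩ := LieModule.vanishingOne (homogeneousSubmodule ι K 2) c fun y z => by
    have h1 : (lieDeriv V (liePoisson b)).1 (linFun b y) (linFun b z) = 0 := by rw [h]; rfl
    rw [lieDeriv_apply, liePoisson_linFun, Bivector.skew _ (V _)] at h1
    ext1
    change V (linFun b ⁅y, z⁆) = (liePoisson b).1 (linFun b y) (V (linFun b z)) -
      (liePoisson b).1 (linFun b z) (V (linFun b y))
    linear_combination h1
  refine ⟨m.1, m.2, derivation_ext fun i => ?_⟩
  rw [← linFun_basis b]
  exact congrArg Subtype.val (hm (b i))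

/-- Quadratic bivectors on `s*` which are cocycles for the Lie--Poisson bivector are
coboundaries. -/
theorem exists_eq_lieDeriv_of_schouten_eq_zero {π : Bivector K (MvPolynomial ι K)}
    (hπ : π.IsQuadratic) (h : schouten π (liePoisson b) = 0) :
    ∃ Y : VectorField K (MvPolynomial ι K), Y.IsQuadratic ∧ π = lieDeriv Y (liePoisson b) := by
  let _ := quadraticLieRingModule b
  have := quadraticLieModule b
  have : FiniteDimensional K s := Module.Finite.of_basis b
  have : FiniteDimensional K (homogeneousSubmodule ι K 2) :=
    Module.Finite.iff_fg.2 (homogeneousSubmodule_fg ι K 2)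
  let ω : s →ₗ[K] s →ₗ[K] homogeneousSubmodule ι K 2 :=
    LinearMap.mk₂ K (fun y z => ⟨π.1 (linFun b y) (linFun b z), bivector_linFun b π hπ y z⟩)
      (fun y y' z => by ext1; simp [linFun_add, π.add_left])
      (fun a y z => by ext1; simp [linFun_smul, π.smul_left])
      (fun y z z' => by ext1; simp [linFun_add, π.add_right])
      (fun a y z => by ext1; simp [linFun_smul, π.smul_right])
  obtain ⟨η, hη⟩ := LieModule.vanishingTwo (homogeneousSubmodule ι K 2) ω
    ⟨fun y => Subtype.ext (π.apply_self _), fun x y z => by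
      have h1 : (schouten π (liePoisson b)).1 (linFun b x) (linFun b y) (linFun b z) = 0 := by
        rw [h]; rfl
      rw [schouten_apply, liePoisson_linFun, liePoisson_linFun, liePoisson_linFun] at h1
      ext1
      refine Eq.trans ?_ h1
      change (liePoisson b).1 (linFun b x) (π.1 (linFun b y) (linFun b z)) +
        (liePoisson b).1 (linFun b y) (π.1 (linFun b z) (linFun b x)) +
        (liePoisson b).1 (linFun b z) (π.1 (linFun b x) (linFun b y)) +
        π.1 (linFun b x) (linFun b ⁅y, z⁆) + π.1 (linFun b y) (linFun b ⁅z, x⁆) +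
        π.1 (linFun b z) (linFun b ⁅x, y⁆) = _
      ring⟩
  -- The sign is needed because $\mathcal L_Y\pi_1$, on linear functions, is minus the coboundary of
  -- `Y`.
  let Y : VectorField K (MvPolynomial ι K) := mkDerivation K fun i => -(η (b i)).1
  have hY : ∀ y, Y (linFun b y) = -(η y).1 := fun y => by
    have : Y.toLinearMap ∘ₗ linFunₗ b = -((homogeneousSubmodule ι K 2).subtype ∘ₗ η) :=
      b.ext fun i => by
        change Y (linFun b (b i)) = -(η (b i)).1
        rw [linFun_basis]
        exact mkDerivation_X _ _ _
    exact LinearMap.congr_fun this y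
  refine ⟨Y, fun i => ?_, Bivector.ext_X fun i j => ?_⟩
  · rw [mkDerivation_X]
    exact (η (b i)).2.neg
  · have h1 : π.1 (linFun b (b i)) (linFun b (b j)) =
        (liePoisson b).1 (linFun b (b i)) (η (b j)).1 -
          (liePoisson b).1 (linFun b (b j)) (η (b i)).1 - (η ⁅b i, b j⁆).1 :=
      congrArg Subtype.val (LinearMap.congr_fun₂ hη (b i) (b j))
    rw [← linFun_basis b, ← linFun_basis b, h1, lieDeriv_apply, liePoisson_linFun, hY, hY, hY,
      Bivector.neg_right, Bivector.neg_left, (liePoisson b).skew (η (b i)).1]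
    ring

end Cohomology

/-! ### Centrally linearizable bivectors and $\widetilde X$. -/

section Extension

variable {K s ι : Type*} [Field K] [LieRing s] [LieAlgebra K s] [Fintype ι]
  (b : Module.Basis ι K s) (a : Module.Dual K (s × K)) (ha : a ≠ 0) (has : ∀ y : s, a (y, 0) = 0)

theorem liePoisson_extends :
    (liePoisson (L := s × K) (adaptedBasis b a ha has)).Extends (liePoisson b) :=
  ⟨liePoisson_extFun b a ha has, fun f => liePoisson_none b a ha has (extFun f)⟩

/-- The term $q\,\partial/\partial x_0$ kills functions on $\mathfrak s^*$. Since $x_0$ is a Casimir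
function, $-x_0E$ acts as $-x_0\mathcal L_E$ and yields $x_0\pi_1$. -/
theorem lieDeriv_tildeField_extFun (Y : VectorField K (MvPolynomial ι K))
    (q f g : MvPolynomial ι K) :
    (lieDeriv (tildeField Y q) (liePoisson (L := s × K) (adaptedBasis b a ha has))).1
        (extFun f) (extFun g) =
      extFun ((lieDeriv Y (liePoisson b)).1 f g) + X none * extFun ((liePoisson b).1 f g) := by
  have hE : euler ((liePoisson b).1 f g) - (liePoisson b).1 (euler f) g -
      (liePoisson b).1 f (euler g) = -(liePoisson b).1 f g :=
    congrArg (fun P : Bivector K (MvPolynomial ι K) => P.1 f g) (lieDeriv_euler_liePoisson b)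
  have hE' := congrArg extFun hE
  simp only [extFun_sub, extFun_neg] at hE'
  simp only [lieDeriv_apply, tildeField_extFun, Bivector.sub_left, Bivector.sub_right,
    Bivector.mul_left, Bivector.mul_right, liePoisson_extFun, liePoisson_none,
    Bivector.skew _ (X none), extFun_sub]
  linear_combination (-X none) * hE'

theorem lieDeriv_tildeField_none (Y : VectorField K (MvPolynomial ι K))
    (q f : MvPolynomial ι K) :
    (lieDeriv (tildeField Y q) (liePoisson (L := s × K) (adaptedBasis b a ha has))).1
        (extFun f) (X none) = -extFun (ham (liePoisson b) q f) := by
  rw [lieDeriv_apply, liePoisson_none, liePoisson_none, tildeField_none, liePoisson_extFun,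
    map_zero, ham_apply]
  ring

theorem lieDeriv_tildeField (Y : VectorField K (MvPolynomial ι K)) (q : MvPolynomial ι K) :
    lieDeriv (tildeField Y q) (liePoisson (L := s × K) (adaptedBasis b a ha has)) =
      lieDeriv (extField Y) (liePoisson (L := s × K) (adaptedBasis b a ha has)) -
        wedge (ham (liePoisson (L := s × K) (adaptedBasis b a ha has)) (extFun q)) (pderiv none) +
        (X none : MvPolynomial (Option ι) K) •
          liePoisson (L := s × K) (adaptedBasis b a ha has) := by
  have he := (liePoisson_extends b a ha has).lieDeriv (extField_extFun Y) (extField_none Y)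
  refine Bivector.ext_option (fun f g => ?_) fun f => ?_
  · rw [lieDeriv_tildeField_extFun]
    change _ = (lieDeriv (extField Y) _).1 _ _ - (wedge _ _).1 _ _ + X none * (liePoisson _).1 _ _
    rw [he.extFun, wedge_apply, pderiv_none_extFun, pderiv_none_extFun, liePoisson_extFun]
    ring
  · rw [lieDeriv_tildeField_none]
    change _ = (lieDeriv (extField Y) _).1 _ _ - (wedge _ _).1 _ _ + X none * (liePoisson _).1 _ _
    rw [he.none, wedge_apply, pderiv_none_extFun, pderiv_X_self, liePoisson_none, ham_apply,
      ham_apply _ _ (extFun f), liePoisson_extFun]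
    ring

variable [CharZero K]

theorem isPoisson_lieDeriv_tildeField_iff (Y : VectorField K (MvPolynomial ι K))
    (q : MvPolynomial ι K) :
    IsPoisson (lieDeriv (tildeField Y q) (liePoisson (L := s × K) (adaptedBasis b a ha has))) ↔
      BasicIdentities (liePoisson b) Y q := by
  have hP := liePoisson_isPoisson b
  rw [isPoisson_iff_of_decomposition (lieDeriv_tildeField_extFun b a ha has Y q)
    (lieDeriv_tildeField_none b a ha has Y q) hP, BasicIdentities, schoutenVF_eq_zero_iff]
  simp [hP.schouten_lieDeriv, hP.lieDeriv_ham]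

variable {b a ha has}

theorem IsCLAt.exists_decomposition {P : Bivector K (MvPolynomial (Option ι) K)}
    (h : IsCLAt (adaptedBasis b a ha has) a P) :
    ∃ (π : Bivector K (MvPolynomial ι K)) (V : VectorField K (MvPolynomial ι K)),
      π.IsQuadratic ∧ V.IsQuadratic ∧
      (∀ f g, P.1 (extFun f) (extFun g) =
        extFun (π.1 f g) + X none * extFun ((liePoisson b).1 f g)) ∧
      ∀ f, P.1 (extFun f) (X none) = -extFun (V f) := by
  -- In the adapted coordinates the point `a` is $(1,0,\dots,0)$, by the normalization $x_0(a)=1$.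
  have ht : translationField (fun i => a (adaptedBasis b a ha has i)) = pderiv none := by
    refine derivation_ext fun i => ?_
    rw [translationField, mkDerivation_X]
    cases i with
    | some i => rw [adaptedBasis_some, has, C_0, pderiv_X_of_ne (by simp)]
    | none =>
      have h1 : ((0 : s), (a (0, 1))⁻¹) = (a (0, 1))⁻¹ • ((0 : s), (1 : K)) := by simp
      rw [adaptedBasis_none, pderiv_X_self, h1, map_smul, smul_eq_mul,
        inv_mul_cancel₀ (central_ne_zero ha has), C_1]
  have hl := h.linearization_eq
  rw [linearization, ht] at hl
  have hl' : ∀ f g, pderiv none (P.1 f g) - P.1 (pderiv none f) g - P.1 f (pderiv none g) =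
      (liePoisson (L := s × K) (adaptedBasis b a ha has)).1 f g := fun f g => by
    rw [← hl]; rfl
  -- The difference $P(f,g)-x_0\pi_1(f,g)$ has zero $x_0$-derivative, so it equals its restriction
  -- to $x_0=0$.
  have h1 : ∀ f g, P.1 (extFun f) (extFun g) = extFun ((restrictBivector P).1 f g) +
      X none * extFun ((liePoisson b).1 f g) := fun f g => by
    have h2 := hl' (extFun f) (extFun g)
    rw [pderiv_none_extFun, pderiv_none_extFun, P.zero_left, P.zero_right, sub_zero, sub_zero,
      liePoisson_extFun] at h2
    rw [← sub_eq_iff_eq_add]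
    refine (extFun_restrictFun ?_).symm.trans (congrArg extFun ?_)
    · rw [map_sub, h2, pderiv_mul, pderiv_X_self, pderiv_none_extFun]
      ring
    · rw [map_sub, map_mul]
      have : restrictFun (X none : MvPolynomial (Option ι) K) = 0 := aeval_X _ _
      rw [this, zero_mul, sub_zero]
      rfl
  have h0 : ∀ f, P.1 (extFun f) (X none) =
      -extFun ((-restrictField (ham P (X none))) f) := fun f => by
    have h2 := hl' (extFun f) (X none)
    rw [pderiv_none_extFun, pderiv_X_self, P.zero_left, P.skew _ 1, ← ham_apply P _ 1,
      Derivation.map_one_eq_zero, neg_zero, sub_zero, sub_zero, liePoisson_none] at h2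
    rw [Derivation.neg_apply, extFun_neg, neg_neg]
    exact (extFun_restrictFun h2).symm
  refine ⟨restrictBivector P, -restrictField (ham P (X none)), fun i j => ?_, fun i => ?_, h1, h0⟩
  · refine (IsHomogeneous.rename_isHomogeneous_iff (Option.some_injective ι)).1 ?_
    change (extFun _).IsHomogeneous 2
    rw [eq_sub_of_add_eq (h1 (X i) (X j)).symm, ← X_some, ← X_some]
    refine (h.quadratic _ _).sub ?_
    rw [liePoisson_X]
    exact (isHomogeneous_X K none).mul (linFun_isHomogeneous b _).rename_isHomogeneous
  · refine (IsHomogeneous.rename_isHomogeneous_iff (Option.some_injective ι)).1 ?_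
    change (extFun _).IsHomogeneous 2
    rw [← neg_neg (extFun _), ← h0, ← X_some]
    exact (h.quadratic _ _).neg

theorem IsCLAt.exists_eq_lieDeriv_tildeField [LieAlgebra.IsKilling K s]
    {P : Bivector K (MvPolynomial (Option ι) K)} (h : IsCLAt (adaptedBasis b a ha has) a P) :
    ∃ (Y : VectorField K (MvPolynomial ι K)) (q : MvPolynomial ι K),
      Y.IsQuadratic ∧ q.IsHomogeneous 2 ∧
      P = lieDeriv (tildeField Y q) (liePoisson (L := s × K) (adaptedBasis b a ha has)) := by
  obtain ⟨π, V, hπ, hV, h1, h0⟩ := h.exists_decomposition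
  obtain ⟨⟨-, hc⟩, -, hd⟩ :=
    (isPoisson_iff_of_decomposition h1 h0 (liePoisson_isPoisson b)).1 h.poisson
  obtain ⟨q, hq, rfl⟩ := exists_eq_ham_of_lieDeriv_eq_zero b hV hd
  obtain ⟨Y, hY, rfl⟩ := exists_eq_lieDeriv_of_schouten_eq_zero b hπ hc
  refine ⟨Y, q, hY, hq, Bivector.ext_option (fun f g => ?_) fun f => ?_⟩
  · rw [h1, lieDeriv_tildeField_extFun]
  · rw [h0, lieDeriv_tildeField_none]

end Extension

end CLPoisson

theorem theorem1 {𝕜 : Type*} [RCLike 𝕜] {s : Type*} [LieRing s] [LieAlgebra 𝕜 s]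
    [LieAlgebra.IsSemisimple 𝕜 s] {ι : Type*} [Fintype ι] (b : Module.Basis ι 𝕜 s)
    (a : Module.Dual 𝕜 (s × 𝕜)) (ha : a ≠ 0) (has : ∀ y : s, a (y, 0) = 0)
    (π₁ : Bivector 𝕜 (MvPolynomial (Option ι) 𝕜))
    (hπ₁ : π₁ = liePoisson (L := s × 𝕜) (adaptedBasis b a ha has)) :
    (∀ π₂ : Bivector 𝕜 (MvPolynomial (Option ι) 𝕜), IsCLAt (adaptedBasis b a ha has) a π₂ →
      ∃ (Y : VectorField 𝕜 (MvPolynomial ι 𝕜)) (q : MvPolynomial ι 𝕜),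
        Y.IsQuadratic ∧ q.IsHomogeneous 2 ∧
        π₂ = lieDeriv (tildeField Y q) π₁ ∧
        π₂ = lieDeriv (extField Y) π₁ - wedge (ham π₁ (extFun q)) (pderiv none)
          + (MvPolynomial.X none : MvPolynomial (Option ι) 𝕜) • π₁ ∧
        BasicIdentities π₁ (extField Y) (extFun q) ∧
        BasicIdentities (liePoisson b) Y q) ∧
    (∀ (Y : VectorField 𝕜 (MvPolynomial ι 𝕜)) (q : MvPolynomial ι 𝕜),
      Y.IsQuadratic → q.IsHomogeneous 2 →
        lieDeriv (tildeField Y q) π₁ =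
          lieDeriv (extField Y) π₁ - wedge (ham π₁ (extFun q)) (pderiv none)
            + (MvPolynomial.X none : MvPolynomial (Option ι) 𝕜) • π₁ ∧
        (IsPoisson (lieDeriv (tildeField Y q) π₁) ↔
          BasicIdentities π₁ (extField Y) (extFun q)) ∧
        (BasicIdentities π₁ (extField Y) (extFun q) ↔ BasicIdentities (liePoisson b) Y q)) := by
  subst hπ₁
  -- In finite dimension and characteristic zero, semisimplicity gives the nondegenerate Killing
  -- form (Cartan's criterion) required by the Whitehead lemmas.
  have : FiniteDimensional 𝕜 s := Module.Finite.of_basis b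
  have : CharZero 𝕜 := RCLike.charZero_rclike
  have hiff : ∀ Y q, BasicIdentities (liePoisson (L := s × 𝕜) (adaptedBasis b a ha has))
      (extField Y) (extFun q) ↔ BasicIdentities (liePoisson b) Y q :=
    (liePoisson_extends b a ha has).basicIdentities_iff
  refine ⟨fun π₂ h => ?_, fun Y q _ _ => ⟨lieDeriv_tildeField b a ha has Y q,
    (isPoisson_lieDeriv_tildeField_iff b a ha has Y q).trans (hiff Y q).symm, hiff Y q⟩⟩
  obtain ⟨Y, q, hY, hq, rfl⟩ := h.exists_eq_lieDeriv_tildeField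
  have hb := (isPoisson_lieDeriv_tildeField_iff b a ha has Y q).1 h.poisson
  exact ⟨Y, q, hY, hq, rfl, lieDeriv_tildeField b a ha has Y q, (hiff Y q).2 hb, hb⟩
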